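/- For $x\in\mathbb R$ let $\|x\|$ denote the distance from $x$ to the nearest integer. An approximation sequence is a positive, non-increasing sequence $\psi=(\psi(n))_{n\ge 1}$ of real numbers. For real $\tau\ge 1$ put \[ \Omega^{(\tau)}=\{\theta\in\mathbb R:\ \text{there is } c>0 \text{ with } \|n\theta\|\ge c/n^{\tau}\text{ for all } n\ge 1\}, \] and let $\Theta^{(\tau)}$ be the set of all $\theta\in\mathbb R$ such that, for every approximation sequence $\psi$ with $\sum_{n\ge1}\psi(n)^{\tau}=\infty$, for almost all $s\in\mathbb R$ (Lebesgue measure) the inequality $\|n\theta-s\|<\psi(n)$ has infinitely many solutions $n\in\mathbb N$. (1) (Tseng) For every real $\tau\ge1$, $\Omega^{(\tau)}=\Theta^{(\tau)}$. (2) (Kurzweil; the case $\tau=1$) A real number $\theta$ is badly approximable, i.e. there is $c>0$ with $\|n\theta\|\ge c/n$ for all $n\ge1$, if and only if for every approximation sequence $\psi$ with $\sum_{n\ge1}\psi(n)=\infty$ and for almost all $s\in\mathbb R$ the inequality $\|n\theta-s\|<\psi(n)$ has infinitely many solutions $n\in\mathbb N$. (3) (Tseng's sequences) Let $\tau\ge1$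 be real and $\theta\in\mathbb R\setminus\Omega^{(\tau)}$. There are positive integers $v_1,v_2,\dots$ with \[ v_{\ell+1}\ge 2v_\ell\quad\text{and}\quad \|v_\ell\theta\|\le\frac{1}{2\,\ell^{2\tau+2}v_\ell^{\tau}}\qquad(\ell\ge1). \] For each such $(v_\ell)_{\ell\ge1}$, with $u_\ell=\lfloor \ell^{2\tau}v_\ell^{\tau}\rfloor$, there is an approximation sequence $\psi$ such that \[ \psi(n)=\frac{1}{2(\ell+1)^2v_{\ell+1}}\qquad\text{for } u_\ell\le n<u_{\ell+1},\ \ell\ge1, \] and every approximation sequence $\psi$ with this property satisfies $\sum_{n\ge1}\psi(n)^{\tau}=\infty$; moreover, if $\theta$ is irrational with principal convergents $p_k/q_k$, then \[ \sum_{k=0}^{\infty}\ \sum_{n=q_k}^{q_{k+1}-1}\min\bigl(\psi(n),\|q_k\theta\|\bigr)<\infty ; \] and for almost all $s\in\mathbb R$ the inequality $\|n\theta-s\|<\psi(n)$ has only finitely many solutions $n\in\mathbb N$. -/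

import Mathlib

open MeasureTheory

/-- The distance `‖x‖` from `x` to the nearest integer. -/
noncomputable def distInt (x : ℝ) : ℝ := |x - round x|

/-- A positive, non-increasing sequence `ψ(1), ψ(2), …`; the value `ψ 0` is irrelevant. -/
structure IsApproxSeq (ψ : ℕ → ℝ) : Prop where
  pos : ∀ n, 1 ≤ n → 0 < ψ n
  anti : ∀ m n, 1 ≤ m → m ≤ n → ψ n ≤ ψ m

/-- The positive integers `n` with `‖nθ - s‖ < ψ(n)`. -/
def solutions (θ : ℝ) (ψ : ℕ → ℝ) (s : ℝ) : Set ℕ :=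
  {n | 1 ≤ n ∧ distInt (n * θ - s) < ψ n}

/-- `∑_{n ≥ 1} ψ(n)^τ = ∞` (the terms are positive for an approximation sequence). -/
def PowDiverges (τ : ℝ) (ψ : ℕ → ℝ) : Prop :=
  ¬ Summable (fun n : ℕ => ψ (n + 1) ^ τ)

/-- `Ω^{(τ)}`. -/
def omegaSet (τ : ℝ) : Set ℝ :=
  {θ | ∃ c : ℝ, 0 < c ∧ ∀ n : ℕ, 1 ≤ n → c / (n : ℝ) ^ τ ≤ distInt (n * θ)}

/-- `Θ^{(τ)}`. -/
def thetaSet (τ : ℝ) : Set ℝ :=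
  {θ | ∀ ψ : ℕ → ℝ, IsApproxSeq ψ → PowDiverges τ ψ →
    ∀ᵐ s : ℝ, (solutions θ ψ s).Infinite}

/-- The badly approximable numbers. -/
def badlyApproximable : Set ℝ :=
  {θ | ∃ c : ℝ, 0 < c ∧ ∀ n : ℕ, 1 ≤ n → c / n ≤ distInt (n * θ)}

/-- The denominator `q_k` of the `k`-th principal convergent of `θ`, as a natural number. -/
noncomputable def convDenom (θ : ℝ) (k : ℕ) : ℕ := ⌊(GenContFract.of θ).dens k⌋₊

/-- The floor in `convDenom` only changes the type: the denominators are natural numbers. -/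
theorem convDenom_cast (θ : ℝ) (k : ℕ) : (convDenom θ k : ℝ) = (GenContFract.of θ).dens k := by
  have key : ∀ k, (∃ a : ℤ, (GenContFract.of θ).dens k = a) ∧
      (∃ a : ℤ, (GenContFract.of θ).dens (k + 1) = a) := by
    intro k
    induction k with
    | zero =>
      refine ⟨⟨1, by simp⟩, ?_⟩
      rcases h : (GenContFract.of θ).s.get? 0 with _ | gp
      · refine ⟨1, ?_⟩
        rw [GenContFract.dens_stable_of_terminated (Nat.zero_le 1)
          (show (GenContFract.of θ).TerminatedAt 0 from h)]
        simp
      · obtain ⟨-, z, hz⟩ := GenContFract.of_partNum_eq_one_and_exists_int_partDen_eq h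
        exact ⟨z, by rw [GenContFract.first_den_eq h, hz]⟩
    | succ k ih =>
      obtain ⟨⟨a, ha⟩, ⟨b, hb⟩⟩ := ih
      refine ⟨⟨b, hb⟩, ?_⟩
      rcases h : (GenContFract.of θ).s.get? (k + 1) with _ | gp
      · exact ⟨b, by rw [GenContFract.dens_stable_of_terminated (Nat.le_succ (k + 1))
          (show (GenContFract.of θ).TerminatedAt (k + 1) from h), hb]⟩
      · obtain ⟨h1, z, hz⟩ := GenContFract.of_partNum_eq_one_and_exists_int_partDen_eq h
        refine ⟨z * b + a, ?_⟩
        rw [GenContFract.dens_recurrence h ha hb, h1, hz]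
        push_cast
        ring
  obtain ⟨⟨a, ha⟩, -⟩ := key k
  have h0 : (0 : ℝ) ≤ (GenContFract.of θ).dens k := GenContFract.zero_le_of_den
  rw [ha] at h0
  have h0' : 0 ≤ a := by exact_mod_cast h0
  lift a to ℕ using h0'
  rw [convDenom, ha]
  simp

/-- The `k`-th term `∑_{n = q_k}^{q_{k+1} - 1} min(ψ(n), ‖q_k θ‖)` of the criterion series. -/
noncomputable def blockSum (θ : ℝ) (ψ : ℕ → ℝ) (k : ℕ) : ℝ :=
  ∑ n ∈ Finset.Ico (convDenom θ k) (convDenom θ (k + 1)),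
    min (ψ n) (distInt (convDenom θ k * θ))

/-- Positive integers `v_1, v_2, …` with `v_{ℓ+1} ≥ 2 v_ℓ` and
`‖v_ℓ θ‖ ≤ 1 / (2 ℓ^{2τ+2} v_ℓ^τ)`. -/
structure IsTsengBase (τ θ : ℝ) (v : ℕ → ℕ) : Prop where
  pos : ∀ l, 1 ≤ l → 1 ≤ v l
  double : ∀ l, 1 ≤ l → 2 * v l ≤ v (l + 1)
  approx : ∀ l, 1 ≤ l →
    distInt (v l * θ) ≤ 1 / (2 * (l : ℝ) ^ (2 * τ + 2) * (v l : ℝ) ^ τ)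

/-- `u_ℓ = ⌊ℓ^{2τ} v_ℓ^τ⌋`. -/
noncomputable def tsengIndex (τ : ℝ) (v : ℕ → ℕ) (l : ℕ) : ℕ :=
  ⌊(l : ℝ) ^ (2 * τ) * (v l : ℝ) ^ τ⌋₊

/-- `ψ` is an approximation sequence with `ψ(n) = 1 / (2 (ℓ+1)^2 v_{ℓ+1})` for
`u_ℓ ≤ n < u_{ℓ+1}`, `ℓ ≥ 1`. The finitely many values `ψ(n)` with `n < u_1`
are not prescribed. -/
structure IsTsengSeq (τ : ℝ) (v : ℕ → ℕ) (ψ : ℕ → ℝ) : Prop where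
  approxSeq : IsApproxSeq ψ
  eq : ∀ l, 1 ≤ l → ∀ n, tsengIndex τ v l ≤ n → n < tsengIndex τ v (l + 1) →
    ψ n = 1 / (2 * ((l : ℝ) + 1) ^ 2 * (v (l + 1) : ℝ))

/-!
Modulo one, the multiples `nθ` with `n < q_{l+1}` are `1 / (2 q_{l+1})`-separated.

Let `θ ∈ Ω^{(τ)}`. Around `nθ`, for `n` up to about `q_{l+1}`, put balls whose radius is constant on
runs of `q_l` consecutive `n` and is at most `1 / (4 q_{l+1})`. Within a block `l` these balls are
disjoint, and each run is equidistributed at scale `1 / q_l`, so the blocks are quasi-independent.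
Since `1 / q_{l+1}` is bounded below by a multiple of `q_l^{-τ}`, divergence of `∑ ψ(n)^τ` makes the
measures of the blocks sum to infinity, unless `ψ(q_l) ≥ 1 / (4 q_l)` infinitely often, in which
case single runs already have measure `1 / 2`. Either way the limsup set has positive measure, and
ergodicity of the rotation by `θ` makes it full.

Conversely, `θ ∉ Ω^{(τ)}` provides `v_ℓ` with `‖v_ℓ θ‖` so small that modulo one `nθ` stays close to
`(n mod v_ℓ)θ` throughout the block `u_{ℓ-1} ≤ n < u_ℓ` of Tseng's sequence. Such a block therefore
approximates only points in `v_ℓ` intervals of length about `1 / (ℓ² v_ℓ)`, and Borel–Cantelli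
applies. In the criterion series the first `v_ℓ` terms of a block are bounded by `ψ(n)`, the others
by `‖v_ℓ θ‖`.
-/

open Filter Metric

theorem distInt_nonneg (x : ℝ) : 0 ≤ distInt x := abs_nonneg _

theorem distInt_le (x : ℝ) (m : ℤ) : distInt x ≤ |x - m| := round_le x m

theorem distInt_natCast_mul_sub (n : ℕ) (θ s : ℝ) :
    distInt (n * θ - s) = ‖n • (θ : UnitAddCircle) - (s : UnitAddCircle)‖ := by
  rw [distInt, ← UnitAddCircle.norm_eq, AddCircle.coe_sub, ← nsmul_eq_mul, AddCircle.coe_nsmul]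

theorem distInt_natCast_mul (n : ℕ) (θ : ℝ) : distInt (n * θ) = ‖n • (θ : UnitAddCircle)‖ := by
  simpa using distInt_natCast_mul_sub n θ 0

section Convergents

/-- The numerator `p_k` of the `k`-th principal convergent of `θ`, as an integer. -/
noncomputable def convNum (θ : ℝ) (k : ℕ) : ℤ := ⌊(GenContFract.of θ).nums k⌋

theorem exists_int_contsAux_a_eq (θ : ℝ) (k : ℕ) :
    ∃ z : ℤ, ((GenContFract.of θ).contsAux k).a = z := by
  induction k using Nat.twoStepInduction with
  | zero => exact ⟨1, by simp⟩
  | one => exact ⟨⌊θ⌋, by simp⟩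
  | more k ih₀ ih₁ =>
    obtain ⟨z₀, h₀⟩ := ih₀
    obtain ⟨z₁, h₁⟩ := ih₁
    rcases hs : (GenContFract.of θ).s.get? k with _ | gp
    · exact ⟨z₁, by rw [GenContFract.contsAux_stable_step_of_terminated hs, h₁]⟩
    · obtain ⟨ha, z, hb⟩ := GenContFract.of_partNum_eq_one_and_exists_int_partDen_eq hs
      refine ⟨z * z₁ + z₀, ?_⟩
      rw [GenContFract.contsAux_recurrence hs rfl rfl, h₀, h₁, ha, hb]
      push_cast
      ring

theorem convNum_cast (θ : ℝ) (k : ℕ) : (convNum θ k : ℝ) = (GenContFract.of θ).nums k := by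
  obtain ⟨z, hz⟩ := exists_int_contsAux_a_eq θ (k + 1)
  have hnum : (GenContFract.of θ).nums k = z := hz
  rw [convNum, hnum, Int.floor_intCast]

theorem convDenom_zero (θ : ℝ) : convDenom θ 0 = 1 := by simp [convDenom]

theorem convDenom_mono (θ : ℝ) : Monotone (convDenom θ) :=
  monotone_nat_of_le_succ fun _ => Nat.floor_mono GenContFract.of_den_mono

theorem convDenom_pos (θ : ℝ) (k : ℕ) : 0 < convDenom θ k :=
  Nat.one_pos.trans_le (convDenom_zero θ ▸ convDenom_mono θ (Nat.zero_le k))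

theorem convDenom_cast_pos (θ : ℝ) (k : ℕ) : (0 : ℝ) < convDenom θ k :=
  Nat.cast_pos.2 (convDenom_pos θ k)

/-- The signed error `q_k θ - p_k` of the `k`-th principal convergent of `θ`. -/
noncomputable def convError (θ : ℝ) (k : ℕ) : ℝ := convDenom θ k * θ - convNum θ k

variable {θ : ℝ}

theorem not_terminatedAt_of_irrational (hθ : Irrational θ) (k : ℕ) :
    ¬ (GenContFract.of θ).TerminatedAt k := fun hk => by
  obtain ⟨q, hq⟩ := (GenContFract.terminates_iff_rat θ).1 ⟨k, hk⟩
  exact hθ ⟨q, hq.symm⟩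

theorem le_convDenom (hθ : Irrational θ) (k : ℕ) : k ≤ convDenom θ k := by
  have hfib : Nat.fib (k + 1) ≤ convDenom θ k := by
    have h := GenContFract.succ_nth_fib_le_of_nth_den (v := θ) (n := k)
      (Or.inr (not_terminatedAt_of_irrational hθ _))
    rw [← convDenom_cast] at h
    exact_mod_cast h
  have := Nat.le_fib_add_one (k + 1)
  omega

theorem tendsto_convDenom (hθ : Irrational θ) : Tendsto (convDenom θ) atTop atTop :=
  tendsto_atTop_mono (le_convDenom hθ) tendsto_id

theorem convDenom_add_le (hθ : Irrational θ) (k : ℕ) :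
    convDenom θ (k + 1) + convDenom θ k ≤ convDenom θ (k + 2) := by
  obtain ⟨gp, hs⟩ := Option.ne_none_iff_exists'.1 (not_terminatedAt_of_irrational hθ (k + 1))
  have hb : (1 : ℝ) ≤ gp.b := GenContFract.of_one_le_get?_partDen (GenContFract.partDen_eq_s_b hs)
  have hrec := GenContFract.dens_recurrence hs (convDenom_cast θ k).symm
    (convDenom_cast θ (k + 1)).symm
  rw [← convDenom_cast, (GenContFract.of_partNum_eq_one_and_exists_int_partDen_eq hs).1,
    one_mul] at hrec
  have hle : (convDenom θ (k + 1) + convDenom θ k : ℝ) ≤ convDenom θ (k + 2) := by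
    rw [hrec]
    gcongr
    exact le_mul_of_one_le_left (Nat.cast_nonneg _) hb
  exact_mod_cast hle

theorem two_mul_convDenom_le (hθ : Irrational θ) (k : ℕ) :
    2 * convDenom θ k ≤ convDenom θ (k + 2) := by
  have h₁ := convDenom_add_le hθ k
  have h₂ : convDenom θ k ≤ convDenom θ (k + 1) := convDenom_mono θ (Nat.le_succ k)
  omega

theorem neg_one_pow_mul_convError_pos (hθ : Irrational θ) (k : ℕ) :
    0 < (-1) ^ k * convError θ k := by
  have hq := convDenom_cast_pos θ k
  have hne : convError θ k ≠ 0 :=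
    sub_ne_zero.2 ((hθ.natCast_mul (convDenom_pos θ k).ne').ne_int _)
  have herr : convError θ k = convDenom θ k * (θ - (GenContFract.of θ).convs k) := by
    rw [GenContFract.conv_eq_num_div_den, ← convDenom_cast, ← convNum_cast, convError]
    field_simp
  obtain ⟨ifp, hifp⟩ : ∃ ifp, GenContFract.IntFractPair.stream θ k = some ifp := by
    cases k with
    | zero => exact ⟨_, GenContFract.IntFractPair.stream_zero θ⟩
    | succ k =>
      exact Option.ne_none_iff_exists'.1 fun hnone => not_terminatedAt_of_irrational hθ k
        (GenContFract.of_terminatedAt_n_iff_succ_nth_intFractPair_stream_eq_none.2 hnone)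
  set pB := ((GenContFract.of θ).contsAux k).b
  have hconv : θ - (GenContFract.of θ).convs k = if ifp.fr = 0 then 0
      else (-1) ^ k / (convDenom θ k * (ifp.fr⁻¹ * convDenom θ k + pB)) := by
    rw [convDenom_cast]
    exact GenContFract.sub_convs_eq hifp
  have hfr : 0 < ifp.fr := (GenContFract.IntFractPair.nth_stream_fr_nonneg hifp).lt_of_ne'
    fun h0 => hne (by rw [herr, hconv, if_pos h0, mul_zero])
  have hden : 0 < ifp.fr⁻¹ * convDenom θ k + pB :=
    add_pos_of_pos_of_nonneg (by positivity) GenContFract.zero_le_of_contsAux_b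
  rw [if_neg hfr.ne'] at hconv
  have hpos : (-1) ^ k * convError θ k = 1 / (ifp.fr⁻¹ * convDenom θ k + pB) := by
    rw [herr, hconv]
    field_simp
    rw [← pow_mul, mul_comm, pow_mul, neg_one_sq, one_pow]
  rw [hpos]
  exact one_div_pos.2 hden

theorem convNum_mul_convDenom_sub (hθ : Irrational θ) (k : ℕ) :
    convNum θ k * convDenom θ (k + 1) - convDenom θ k * convNum θ (k + 1) = (-1) ^ (k + 1) := by
  have h := SimpContFract.determinant (s := SimpContFract.of θ)
    (not_terminatedAt_of_irrational hθ k)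
  change (GenContFract.of θ).nums k * (GenContFract.of θ).dens (k + 1) -
    (GenContFract.of θ).dens k * (GenContFract.of θ).nums (k + 1) = _ at h
  simp only [← convDenom_cast, ← convNum_cast] at h
  exact_mod_cast h

theorem abs_convError (hθ : Irrational θ) (k : ℕ) :
    |convError θ k| = (-1) ^ k * convError θ k := by
  rw [← abs_of_pos (neg_one_pow_mul_convError_pos hθ k), abs_mul, abs_neg_one_pow, one_mul]

theorem convDenom_mul_abs_convError_add (hθ : Irrational θ) (k : ℕ) :
    convDenom θ (k + 1) * |convError θ k| + convDenom θ k * |convError θ (k + 1)| = 1 := by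
  have hdet : (convNum θ k * convDenom θ (k + 1) - convDenom θ k * convNum θ (k + 1) : ℝ) =
      (-1) ^ (k + 1) := by exact_mod_cast convNum_mul_convDenom_sub hθ k
  have hsq : ((-1 : ℝ) ^ k) * (-1) ^ k = 1 := by rw [← mul_pow]; simp
  rw [abs_convError hθ, abs_convError hθ, convError, convError]
  rw [pow_succ] at hdet ⊢
  linear_combination hsq - (-1) ^ k * hdet

theorem abs_convError_le (hθ : Irrational θ) (k : ℕ) :
    |convError θ k| ≤ 1 / convDenom θ (k + 1) := by
  rw [le_div_iff₀' (convDenom_cast_pos θ _), ← convDenom_mul_abs_convError_add hθ k]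
  exact le_add_of_nonneg_right (by positivity)

theorem one_div_le_abs_convError (hθ : Irrational θ) (k : ℕ) :
    1 / (2 * convDenom θ (k + 1)) ≤ |convError θ k| := by
  have hsum := convDenom_mul_abs_convError_add hθ k
  have hnext : convDenom θ k * |convError θ (k + 1)| ≤ 1 / 2 := by
    have hq : (2 * convDenom θ k : ℝ) ≤ convDenom θ (k + 2) := by
      exact_mod_cast two_mul_convDenom_le hθ k
    have he := abs_convError_le hθ (k + 1)
    rw [le_div_iff₀ (convDenom_cast_pos θ _)] at he
    nlinarith [abs_nonneg (convError θ (k + 1))]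
  rw [div_le_iff₀ (mul_pos two_pos (convDenom_cast_pos θ _))]
  linarith

theorem exists_eq_convDenom_combination (hθ : Irrational θ) (k : ℕ) (n m : ℤ) :
    ∃ a b : ℤ, n = a * convDenom θ k + b * convDenom θ (k + 1) ∧
      m = a * convNum θ k + b * convNum θ (k + 1) := by
  have hdet := convNum_mul_convDenom_sub hθ k
  have hsq : ((-1 : ℤ) ^ (k + 1)) * (-1) ^ (k + 1) = 1 := by rw [← mul_pow]; simp
  refine ⟨(-1) ^ (k + 1) * (m * convDenom θ (k + 1) - n * convNum θ (k + 1)),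
    (-1) ^ (k + 1) * (n * convNum θ k - m * convDenom θ k), ?_, ?_⟩
  · linear_combination (-n) * hsq - n * (-1) ^ (k + 1) * hdet
  · linear_combination (-m) * hsq - m * (-1) ^ (k + 1) * hdet

theorem ne_zero_and_mul_nonpos_of_combination_lt {q q' a b : ℤ} (hq : 0 < q)
    (hpos : 0 < a * q + b * q') (hlt : a * q + b * q' < q') : a ≠ 0 ∧ a * b ≤ 0 := by
  have hq' : 0 < q' := hpos.trans hlt
  constructor
  · rintro rfl
    have hb : 0 < b := by by_contra! hb; nlinarith
    nlinarith
  · by_contra! hab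
    rcases pos_and_pos_or_neg_and_neg_of_mul_pos hab with ⟨ha, hb⟩ | ⟨ha, hb⟩ <;> nlinarith

/- Consecutive errors have opposite signs, so there is no cancellation. -/
theorem abs_mul_convError_add (hθ : Irrational θ) (k : ℕ) {a b : ℝ} (hab : a * b ≤ 0) :
    |a * convError θ k + b * convError θ (k + 1)| =
      |a * convError θ k| + |b * convError θ (k + 1)| := by
  refine (abs_add_eq_add_abs_iff _ _).2 (mul_nonneg_iff.1 ?_)
  have hprod : a * convError θ k * (b * convError θ (k + 1)) =
      -(a * b) * (|convError θ k| * |convError θ (k + 1)|) := by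
    have hsq : ((-1 : ℝ) ^ k) * (-1) ^ k = 1 := by rw [← mul_pow]; simp
    rw [abs_convError hθ, abs_convError hθ, pow_succ]
    linear_combination (-(a * b * convError θ k * convError θ (k + 1))) * hsq
  rw [hprod]
  exact mul_nonneg (neg_nonneg.2 hab) (by positivity)

theorem abs_convError_le_abs_sub (hθ : Irrational θ) {k n : ℕ} (hn : 1 ≤ n)
    (hnk : n < convDenom θ (k + 1)) (m : ℤ) : |convError θ k| ≤ |n * θ - m| := by
  obtain ⟨a, b, hn', hm⟩ := exists_eq_convDenom_combination hθ k n m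
  obtain ⟨ha, hab⟩ := ne_zero_and_mul_nonpos_of_combination_lt
    (a := a) (b := b) (Nat.cast_pos.2 (convDenom_pos θ k)) (hn' ▸ Nat.cast_pos.2 hn)
    (hn' ▸ Nat.cast_lt.2 hnk)
  have hcomb : (n * θ - m : ℝ) = a * convError θ k + b * convError θ (k + 1) := by
    have hnℝ : (n : ℝ) = a * convDenom θ k + b * convDenom θ (k + 1) := by exact_mod_cast hn'
    rw [hnℝ, hm, convError, convError]
    push_cast
    ring
  have ha₁ : (1 : ℝ) ≤ |(a : ℝ)| := by exact_mod_cast Int.one_le_abs ha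
  calc |convError θ k| ≤ |(a : ℝ)| * |convError θ k| := le_mul_of_one_le_left (abs_nonneg _) ha₁
    _ = |a * convError θ k| := (abs_mul _ _).symm
    _ ≤ |n * θ - m| := by
      rw [hcomb, abs_mul_convError_add hθ k (by exact_mod_cast hab)]
      exact le_add_of_nonneg_right (abs_nonneg _)

theorem distInt_convDenom_mul_le (hθ : Irrational θ) (k : ℕ) :
    distInt (convDenom θ k * θ) ≤ 1 / convDenom θ (k + 1) :=
  (distInt_le _ (convNum θ k)).trans (abs_convError_le hθ k)

theorem distInt_convDenom_mul_le_distInt (hθ : Irrational θ) {k n : ℕ} (hn : 1 ≤ n)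
    (hnk : n < convDenom θ (k + 1)) : distInt (convDenom θ k * θ) ≤ distInt (n * θ) :=
  (distInt_le _ (convNum θ k)).trans (abs_convError_le_abs_sub hθ hn hnk _)

theorem one_div_le_distInt (hθ : Irrational θ) {k n : ℕ} (hn : 1 ≤ n)
    (hnk : n < convDenom θ (k + 1)) : 1 / (2 * convDenom θ (k + 1)) ≤ distInt (n * θ) :=
  (one_div_le_abs_convError hθ k).trans (abs_convError_le_abs_sub hθ hn hnk _)

end Convergents

section Blocks

theorem sum_range_sum_Ico {M : Type*} [AddCommMonoid M] {u : ℕ → ℕ} (hu : Monotone u)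
    (f : ℕ → M) (L : ℕ) :
    ∑ l ∈ Finset.range L, ∑ n ∈ Finset.Ico (u l) (u (l + 1)), f n =
      ∑ n ∈ Finset.Ico (u 0) (u L), f n := by
  induction L with
  | zero => simp
  | succ L ih =>
    rw [Finset.sum_range_succ, ih,
      Finset.sum_Ico_consecutive _ (hu (Nat.zero_le L)) (hu (Nat.le_succ L))]

theorem summable_sum_Ico_iff {u : ℕ → ℕ} (hu : Monotone u) (hu' : Tendsto u atTop atTop)
    {f : ℕ → ℝ} (hf : ∀ n, u 0 ≤ n → 0 ≤ f n) :
    Summable (fun l => ∑ n ∈ Finset.Ico (u l) (u (l + 1)), f n) ↔ Summable f := by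
  have hpartial : ∀ L, ∑ l ∈ Finset.range L, ∑ n ∈ Finset.Ico (u l) (u (l + 1)), f n =
      ∑ n ∈ Finset.range (u L - u 0), f (n + u 0) := fun L => by
    rw [sum_range_sum_Ico hu, Finset.sum_Ico_eq_sum_range]
    simp only [add_comm]
  have hsub : Tendsto (fun L => u L - u 0) atTop atTop := (tendsto_sub_atTop_nat _).comp hu'
  have hmono : Monotone fun N => ∑ n ∈ Finset.range N, f (n + u 0) :=
    monotone_nat_of_le_succ fun N => by
      rw [Finset.sum_range_succ]
      exact le_add_of_nonneg_right (hf _ (Nat.le_add_left _ _))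
  rw [← summable_nat_add_iff (f := f) (u 0),
    summable_iff_not_tendsto_nat_atTop_of_nonneg fun n => hf _ (Nat.le_add_left _ _),
    summable_iff_not_tendsto_nat_atTop_of_nonneg fun l => Finset.sum_nonneg fun n hn =>
      hf n ((hu (Nat.zero_le l)).trans (Finset.mem_Ico.1 hn).1)]
  simp only [hpartial]
  exact not_congr ⟨fun h => tendsto_atTop_of_monotone_of_subseq hmono h, fun h => h.comp hsub⟩

theorem exists_monotone_blockIndex {u : ℕ → ℕ} (hu : Monotone u) (hu' : Tendsto u atTop atTop) :
    ∃ L : ℕ → ℕ, Monotone L ∧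
      ∀ n, u 0 ≤ n → ∀ l, L n = l ↔ u l ≤ n ∧ n < u (l + 1) := by
  classical
  have hex : ∀ n, ∃ l, n < u (l + 1) := fun n =>
    (((tendsto_add_atTop_iff_nat 1).2 hu').eventually_gt_atTop n).exists
  refine ⟨fun n => Nat.find (hex n), fun m n hmn =>
    Nat.find_min' _ (hmn.trans_lt (Nat.find_spec (hex n))), fun n hn l => ?_⟩
  rw [Nat.find_eq_iff]
  constructor
  · rintro ⟨hlt, hmin⟩
    refine ⟨?_, hlt⟩
    cases l with
    | zero => exact hn
    | succ l => exact not_lt.1 (hmin l (Nat.lt_succ_self l))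
  · rintro ⟨hle, hlt⟩
    exact ⟨hlt, fun m hm => not_lt.2 ((hu hm).trans hle)⟩

theorem sum_Ico_le_mul_add_mul {f : ℕ → ℝ} {a b V : ℕ} {A B : ℝ} (hA : 0 ≤ A) (hB : 0 ≤ B)
    (hfA : ∀ n ∈ Finset.Ico a b, f n ≤ A) (hfB : ∀ n ∈ Finset.Ico a b, V ≤ n → f n ≤ B) :
    ∑ n ∈ Finset.Ico a b, f n ≤ V * A + b * B := by
  have hterm : ∀ n ∈ Finset.Ico a b, f n ≤ (if n < V then A else 0) + B := fun n hn => by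
    split_ifs with h
    · exact (hfA n hn).trans (le_add_of_nonneg_right hB)
    · rw [zero_add]
      exact hfB n hn (not_lt.1 h)
  have hcard : (Finset.filter (· < V) (Finset.Ico a b)).card ≤ V := by
    refine (Finset.card_le_card fun n hn => ?_).trans_eq (Finset.card_range V)
    exact Finset.mem_range.2 (Finset.mem_filter.1 hn).2
  calc ∑ n ∈ Finset.Ico a b, f n ≤ ∑ n ∈ Finset.Ico a b, ((if n < V then A else 0) + B) :=
        Finset.sum_le_sum hterm
    _ = (Finset.filter (· < V) (Finset.Ico a b)).card * A + ((b - a : ℕ) : ℝ) * B := by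
      rw [Finset.sum_add_distrib, ← Finset.sum_filter, Finset.sum_const, Finset.sum_const,
        Nat.card_Ico, nsmul_eq_mul, nsmul_eq_mul]
    _ ≤ V * A + b * B := by gcongr; exact Nat.sub_le _ _

end Blocks

section Circle

theorem ae_real_of_ae_circle {P : UnitAddCircle → Prop} (h : ∀ᵐ x : UnitAddCircle, P x) :
    ∀ᵐ s : ℝ, P (s : UnitAddCircle) := by
  have hIoc : ∀ a : ℤ, ∀ᵐ s : ℝ ∂volume.restrict (Set.Ioc (a : ℝ) (a + 1)),
      P (s : UnitAddCircle) := fun a =>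
    (UnitAddCircle.measurePreserving_mk (a : ℝ)).quasiMeasurePreserving.ae h
  rw [← Measure.restrict_univ (μ := volume), ← iUnion_Ioc_intCast]
  exact (ae_restrict_iUnion_iff _ _).2 hIoc

theorem volume_closedBall_le (x : UnitAddCircle) (r : ℝ) :
    volume (closedBall x r) ≤ ENNReal.ofReal (2 * r) := by
  rw [AddCircle.volume_closedBall]
  exact ENNReal.ofReal_le_ofReal (min_le_right _ _)

theorem norm_nsmul_sub_mod_nsmul_le {E : Type*} [SeminormedAddCommGroup E] (α : E) (n V : ℕ) :
    ‖n • α - (n % V) • α‖ ≤ n / V * ‖V • α‖ := by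
  have hdiv : n • α - (n % V) • α = (n / V) • (V • α) := by
    rw [sub_eq_iff_eq_add', ← mul_nsmul, ← add_nsmul, Nat.mod_add_div]
  calc ‖n • α - (n % V) • α‖ ≤ (n / V : ℕ) * ‖V • α‖ := hdiv ▸ norm_nsmul_le
    _ ≤ n / V * ‖V • α‖ := by gcongr; exact Nat.cast_div_le

end Circle

section Tseng

variable {τ θ : ℝ}

theorem mem_omegaSet_of_forall_ge {c : ℝ} (hc : 0 < c) {N : ℕ}
    (h : ∀ n : ℕ, N ≤ n → c / (n : ℝ) ^ τ ≤ distInt (n * θ)) : θ ∈ omegaSet τ := by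
  have hM : (0 : ℝ) < (N + 1 : ℕ) := Nat.cast_pos.2 N.succ_pos
  refine ⟨c / ((N + 1 : ℕ) ^ τ * (N + 1 : ℕ)), by positivity, fun n hn => ?_⟩
  have hn₀ : (0 : ℝ) < n := Nat.cast_pos.2 hn
  have hmul : distInt ((((N + 1) * n : ℕ) : ℝ) * θ) ≤ (N + 1 : ℕ) * distInt (n * θ) := by
    rw [distInt_natCast_mul, distInt_natCast_mul, mul_comm, mul_nsmul]
    exact norm_nsmul_le
  have hlow := h ((N + 1) * n) (by nlinarith)
  rw [Nat.cast_mul, Real.mul_rpow hM.le hn₀.le] at hlow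
  rw [Nat.cast_mul] at hmul
  calc c / ((N + 1 : ℕ) ^ τ * (N + 1 : ℕ)) / (n : ℝ) ^ τ
      = c / ((N + 1 : ℕ) ^ τ * (n : ℝ) ^ τ) / (N + 1 : ℕ) := by field_simp
    _ ≤ (N + 1 : ℕ) * distInt (n * θ) / (N + 1 : ℕ) := by gcongr; exact hlow.trans hmul
    _ = distInt (n * θ) := by field_simp

theorem exists_isTsengBase (hθ : θ ∉ omegaSet τ) : ∃ v : ℕ → ℕ, IsTsengBase τ θ v := by
  have hex : ∀ l N : ℕ, ∃ n : ℕ, max N 1 ≤ n ∧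
      distInt (n * θ) ≤ 1 / (2 * ((l + 1 : ℕ) : ℝ) ^ (2 * τ + 2) * (n : ℝ) ^ τ) := by
    intro l N
    by_contra! hcon
    refine hθ (mem_omegaSet_of_forall_ge (c := 1 / (2 * ((l + 1 : ℕ) : ℝ) ^ (2 * τ + 2)))
      (by positivity) (N := max N 1) fun n hn => ?_)
    rw [div_div]
    exact (hcon n hn).le
  choose g hgN hg using hex
  let v : ℕ → ℕ := fun l => Nat.rec 0 (fun l x => g l (2 * x)) l
  refine ⟨v, fun l hl => ?_, fun l _ => (le_max_left _ _).trans (hgN l (2 * v l)), fun l hl => ?_⟩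
  · obtain ⟨l, rfl⟩ := Nat.exists_eq_succ_of_ne_zero (Nat.one_le_iff_ne_zero.1 hl)
    exact (le_max_right _ _).trans (hgN l (2 * v l))
  · obtain ⟨l, rfl⟩ := Nat.exists_eq_succ_of_ne_zero (Nat.one_le_iff_ne_zero.1 hl)
    exact hg l (2 * v l)

/-- The number `ℓ^{2τ} v_ℓ^τ`, whose integer part is the index `u_ℓ`. -/
noncomputable def tsengScale (τ : ℝ) (v : ℕ → ℕ) (l : ℕ) : ℝ :=
  (l : ℝ) ^ (2 * τ) * (v l : ℝ) ^ τ

variable {v : ℕ → ℕ}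

namespace IsTsengBase

theorem cast_pos (hv : IsTsengBase τ θ v) (l : ℕ) : (0 : ℝ) < v (l + 1) :=
  Nat.cast_pos.2 (hv.pos _ l.succ_pos)

theorem monotone_succ (hv : IsTsengBase τ θ v) : Monotone fun l => v (l + 1) :=
  monotone_nat_of_le_succ fun l => by
    have := hv.double (l + 1) l.succ_pos
    omega

theorem one_le_tsengScale (hv : IsTsengBase τ θ v) (hτ : 0 ≤ τ) (l : ℕ) :
    1 ≤ tsengScale τ v (l + 1) := by
  have hl : (1 : ℝ) ≤ (l + 1 : ℕ) := by exact_mod_cast l.succ_pos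
  have hvl : (1 : ℝ) ≤ v (l + 1) := by exact_mod_cast hv.pos _ l.succ_pos
  exact one_le_mul_of_one_le_of_one_le (Real.one_le_rpow hl (by positivity))
    (Real.one_le_rpow hvl hτ)

theorem two_mul_tsengScale_le (hv : IsTsengBase τ θ v) (hτ : 1 ≤ τ) (l : ℕ) :
    2 * tsengScale τ v (l + 1) ≤ tsengScale τ v (l + 2) := by
  have hpos := hv.cast_pos l
  have hdouble : (2 * v (l + 1) : ℝ) ≤ v (l + 2) := by
    exact_mod_cast hv.double (l + 1) l.succ_pos
  have hpow : (2 : ℝ) ≤ 2 ^ τ := by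
    simpa using Real.rpow_le_rpow_of_exponent_le (by norm_num : (1 : ℝ) ≤ 2) hτ
  calc 2 * tsengScale τ v (l + 1) ≤ 2 ^ τ * tsengScale τ v (l + 1) := by
        gcongr
        exact zero_le_one.trans (hv.one_le_tsengScale (by linarith) l)
    _ = ((l + 1 : ℕ) : ℝ) ^ (2 * τ) * (2 * v (l + 1) : ℝ) ^ τ := by
        rw [tsengScale, Real.mul_rpow (by norm_num) hpos.le]; ring
    _ ≤ tsengScale τ v (l + 2) := by
        rw [tsengScale]
        gcongr
        simp

theorem four_le_tsengScale (hv : IsTsengBase τ θ v) (hτ : 1 ≤ τ) (l : ℕ) :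
    4 ≤ tsengScale τ v (l + 2) := by
  have hl : (2 : ℝ) ≤ ((l + 2 : ℕ) : ℝ) := by simp
  have hvl : (1 : ℝ) ≤ v (l + 2) := by exact_mod_cast hv.pos _ (Nat.succ_pos _)
  calc (4 : ℝ) = 2 ^ (2 : ℝ) * 1 := by norm_num
    _ ≤ 2 ^ (2 * τ) * (v (l + 2) : ℝ) ^ τ := by
      gcongr
      · norm_num
      · linarith
      · exact Real.one_le_rpow hvl (by linarith)
    _ ≤ tsengScale τ v (l + 2) := by rw [tsengScale]; gcongr

theorem tsengIndex_le_tsengScale (hv : IsTsengBase τ θ v) (hτ : 0 ≤ τ) (l : ℕ) :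
    tsengIndex τ v (l + 1) ≤ tsengScale τ v (l + 1) :=
  Nat.floor_le (zero_le_one.trans (hv.one_le_tsengScale hτ l))

theorem tsengScale_div_four_le (hv : IsTsengBase τ θ v) (hτ : 1 ≤ τ) (l : ℕ) :
    tsengScale τ v (l + 2) / 4 ≤ tsengIndex τ v (l + 2) - tsengIndex τ v (l + 1) := by
  have hfour := hv.four_le_tsengScale hτ l
  have hdouble := hv.two_mul_tsengScale_le hτ l
  have hle := hv.tsengIndex_le_tsengScale (by linarith) l
  have hlt : tsengScale τ v (l + 2) < tsengIndex τ v (l + 2) + 1 := Nat.lt_floor_add_one _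
  linarith

theorem strictMono_tsengIndex_succ (hv : IsTsengBase τ θ v) (hτ : 1 ≤ τ) :
    StrictMono fun l => tsengIndex τ v (l + 1) :=
  strictMono_nat_of_lt_succ fun l => by
    have hdiff := hv.tsengScale_div_four_le hτ l
    have hfour := hv.four_le_tsengScale hτ l
    have hlt : (tsengIndex τ v (l + 1) : ℝ) < tsengIndex τ v (l + 2) := by linarith
    exact_mod_cast hlt

theorem one_le_tsengIndex (hv : IsTsengBase τ θ v) (hτ : 0 ≤ τ) (l : ℕ) :
    1 ≤ tsengIndex τ v (l + 1) :=
  Nat.le_floor (by exact_mod_cast hv.one_le_tsengScale hτ l)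

theorem mul_distInt_le (hv : IsTsengBase τ θ v) (hτ : 0 ≤ τ) {l n : ℕ}
    (hn : n ≤ tsengIndex τ v (l + 2)) :
    n * distInt (v (l + 2) * θ) ≤ 1 / (2 * ((l : ℝ) + 2) ^ 2) := by
  have hscale : 0 < tsengScale τ v (l + 2) := one_pos.trans_le (hv.one_le_tsengScale hτ (l + 1))
  have happrox : distInt (v (l + 2) * θ) ≤
      1 / (2 * ((l : ℝ) + 2) ^ 2 * tsengScale τ v (l + 2)) := by
    refine (hv.approx (l + 2) (Nat.succ_pos _)).trans_eq ?_
    rw [tsengScale, Real.rpow_add (by positivity), Real.rpow_two]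
    push_cast
    ring
  calc n * distInt (v (l + 2) * θ)
      ≤ tsengScale τ v (l + 2) * (1 / (2 * ((l : ℝ) + 2) ^ 2 * tsengScale τ v (l + 2))) := by
        gcongr
        · exact distInt_nonneg _
        · exact (Nat.cast_le.2 hn).trans (hv.tsengIndex_le_tsengScale hτ (l + 1))
    _ = 1 / (2 * ((l : ℝ) + 2) ^ 2) := by field_simp

theorem exists_isTsengSeq (hv : IsTsengBase τ θ v) (hτ : 1 ≤ τ) :
    ∃ ψ : ℕ → ℝ, IsTsengSeq τ v ψ := by
  have hu := hv.strictMono_tsengIndex_succ hτ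
  obtain ⟨L, hLmono, hL⟩ := exists_monotone_blockIndex hu.monotone hu.tendsto_atTop
  have hpos : ∀ l : ℕ, (0 : ℝ) < 2 * ((l : ℝ) + 2) ^ 2 * v (l + 2) := fun l => by
    have := hv.cast_pos (l + 1)
    positivity
  refine ⟨fun n => 1 / (2 * ((L n : ℝ) + 2) ^ 2 * v (L n + 2)),
    ⟨fun n _ => one_div_pos.2 (hpos _), fun m n _ hmn => ?_⟩, fun l hl n hln hnl => ?_⟩
  · have hLmn := hLmono hmn
    have hvmn : v (L m + 2) ≤ v (L n + 2) := hv.monotone_succ (Nat.succ_le_succ hLmn)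
    refine one_div_le_one_div_of_le (hpos _) ?_
    gcongr
  · obtain ⟨l, rfl⟩ := Nat.exists_eq_succ_of_ne_zero (Nat.one_le_iff_ne_zero.1 hl)
    have hLn : L n = l := (hL n ((hu.monotone (Nat.zero_le l)).trans hln) l).2 ⟨hln, hnl⟩
    simp only [hLn]
    push_cast
    ring

end IsTsengBase

theorem summable_one_div_add_two_sq : Summable fun l : ℕ => 1 / ((l : ℝ) + 2) ^ 2 := by
  simpa using (summable_nat_add_iff 2).2 (Real.summable_one_div_nat_pow.2 one_lt_two)

namespace IsTsengSeq

variable {ψ : ℕ → ℝ}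

theorem eq_on_block (hψ : IsTsengSeq τ v ψ) {l n : ℕ}
    (hn : n ∈ Finset.Ico (tsengIndex τ v (l + 1)) (tsengIndex τ v (l + 2))) :
    ψ n = 1 / (2 * ((l : ℝ) + 2) ^ 2 * v (l + 2)) := by
  rw [hψ.eq (l + 1) l.succ_pos n (Finset.mem_Ico.1 hn).1 (Finset.mem_Ico.1 hn).2]
  push_cast
  ring

theorem rpow_eq_on_block (hψ : IsTsengSeq τ v ψ) {l n : ℕ}
    (hn : n ∈ Finset.Ico (tsengIndex τ v (l + 1)) (tsengIndex τ v (l + 2))) :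
    ψ n ^ τ = 1 / (2 ^ τ * tsengScale τ v (l + 2)) := by
  rw [hψ.eq_on_block hn, tsengScale, Real.div_rpow (by norm_num) (by positivity), Real.one_rpow,
    Real.mul_rpow (by positivity) (by positivity), Real.mul_rpow (by norm_num) (by positivity),
    Real.rpow_mul (by positivity), Real.rpow_two, mul_assoc]
  push_cast
  rfl

theorem powDiverges (hψ : IsTsengSeq τ v ψ) (hv : IsTsengBase τ θ v) (hτ : 1 ≤ τ) :
    PowDiverges τ ψ := by
  intro hsum
  have hu := hv.strictMono_tsengIndex_succ hτ
  have hblock : ∀ l, 1 / (4 * 2 ^ τ) ≤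
      ∑ n ∈ Finset.Ico (tsengIndex τ v (l + 1)) (tsengIndex τ v (l + 2)), ψ n ^ τ := fun l => by
    have hscale := hv.four_le_tsengScale hτ l
    rw [Finset.sum_congr rfl fun n hn => hψ.rpow_eq_on_block hn, Finset.sum_const, Nat.card_Ico,
      nsmul_eq_mul, Nat.cast_sub (hu.monotone l.le_succ)]
    calc 1 / (4 * 2 ^ τ) = tsengScale τ v (l + 2) / 4 * (1 / (2 ^ τ * tsengScale τ v (l + 2))) := by
          field_simp
      _ ≤ _ := by gcongr; exact hv.tsengScale_div_four_le hτ l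
  have hlim := ((summable_sum_Ico_iff hu.monotone hu.tendsto_atTop fun n hn =>
    Real.rpow_nonneg (hψ.approxSeq.pos n ((hv.one_le_tsengIndex (by linarith) 0).trans hn)).le τ).2
    ((summable_nat_add_iff (f := fun n => ψ n ^ τ) 1).1 hsum)).tendsto_atTop_zero
  obtain ⟨l, hl⟩ := (hlim.eventually_lt_const (by positivity : 0 < 1 / (4 * (2 : ℝ) ^ τ))).exists
  exact (hblock l).not_gt hl

theorem sum_block_min_le (hψ : IsTsengSeq τ v ψ) (hv : IsTsengBase τ θ v) (hτ : 0 ≤ τ)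
    {δ : ℕ → ℝ} (hδ : ∀ m n : ℕ, 1 ≤ m → m ≤ n → δ n ≤ distInt (m * θ)) (l : ℕ) :
    ∑ n ∈ Finset.Ico (tsengIndex τ v (l + 1)) (tsengIndex τ v (l + 2)), min (ψ n) (δ n) ≤
      1 / ((l : ℝ) + 2) ^ 2 := by
  have hV := hv.cast_pos (l + 1)
  calc ∑ n ∈ Finset.Ico (tsengIndex τ v (l + 1)) (tsengIndex τ v (l + 2)), min (ψ n) (δ n)
      ≤ v (l + 2) * (1 / (2 * ((l : ℝ) + 2) ^ 2 * v (l + 2))) +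
          tsengIndex τ v (l + 2) * distInt (v (l + 2) * θ) :=
        sum_Ico_le_mul_add_mul (by positivity) (distInt_nonneg _)
          (fun n hn => (min_le_left _ _).trans_eq (hψ.eq_on_block hn))
          fun n _ hVn => (min_le_right _ _).trans (hδ _ n (hv.pos _ (Nat.succ_pos _)) hVn)
    _ ≤ 1 / (2 * ((l : ℝ) + 2) ^ 2) + 1 / (2 * ((l : ℝ) + 2) ^ 2) := by
        gcongr
        · exact (by field_simp : _ = _).le
        · exact hv.mul_distInt_le hτ le_rfl
    _ = 1 / ((l : ℝ) + 2) ^ 2 := by field_simp; norm_num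

theorem summable_blockSum (hψ : IsTsengSeq τ v ψ) (hv : IsTsengBase τ θ v) (hτ : 1 ≤ τ)
    (hθ : Irrational θ) : Summable (blockSum θ ψ) := by
  obtain ⟨K, -, hK⟩ := exists_monotone_blockIndex (convDenom_mono θ) (tendsto_convDenom hθ)
  let f : ℕ → ℝ := fun n => min (ψ n) (distInt (convDenom θ (K n) * θ))
  have hf : ∀ n, 1 ≤ n → 0 ≤ f n := fun n hn =>
    le_min (hψ.approxSeq.pos n hn).le (distInt_nonneg _)
  have hbest : ∀ m n : ℕ, 1 ≤ m → m ≤ n →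
      distInt (convDenom θ (K n) * θ) ≤ distInt (m * θ) := fun m n hm hmn =>
    distInt_convDenom_mul_le_distInt hθ hm (hmn.trans_lt
      ((hK n (convDenom_zero θ ▸ hm.trans hmn) _).1 rfl).2)
  have hu := hv.strictMono_tsengIndex_succ hτ
  have hτ₀ : 0 ≤ τ := zero_le_one.trans hτ
  have hsum : Summable f := by
    refine (summable_sum_Ico_iff hu.monotone hu.tendsto_atTop fun n hn =>
      hf n ((hv.one_le_tsengIndex hτ₀ 0).trans hn)).1 ?_
    refine Summable.of_nonneg_of_le (fun l => Finset.sum_nonneg fun n hn => hf n ?_)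
      (hψ.sum_block_min_le hv hτ₀ hbest) summable_one_div_add_two_sq
    exact (hv.one_le_tsengIndex hτ₀ l).trans (Finset.mem_Ico.1 hn).1
  have hblock : blockSum θ ψ = fun k =>
      ∑ n ∈ Finset.Ico (convDenom θ k) (convDenom θ (k + 1)), f n := by
    funext k
    refine Finset.sum_congr rfl fun n hn => ?_
    have hkn := Finset.mem_Ico.1 hn
    rw [← (hK n ((convDenom_mono θ k.zero_le).trans hkn.1) k).2 hkn]
  rw [hblock]
  exact (summable_sum_Ico_iff (convDenom_mono θ) (tendsto_convDenom hθ) fun n hn =>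
    hf n (convDenom_zero θ ▸ hn)).2 hsum

/- Modulo one, `n θ` differs from `(n % v_{ℓ+2}) θ` by at most `n / v_{ℓ+2} * ‖v_{ℓ+2} θ‖`, so on a
whole block the points `n θ` stay close to `v_{ℓ+2}` points. -/
theorem norm_mod_nsmul_sub_le (hψ : IsTsengSeq τ v ψ) (hv : IsTsengBase τ θ v) (hτ : 0 ≤ τ)
    {l n : ℕ} (hn : n ∈ Finset.Ico (tsengIndex τ v (l + 1)) (tsengIndex τ v (l + 2))) {s : ℝ}
    (hs : n ∈ solutions θ ψ s) :
    ‖(n % v (l + 2)) • (θ : UnitAddCircle) - (s : UnitAddCircle)‖ ≤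
      1 / (((l : ℝ) + 2) ^ 2 * v (l + 2)) := by
  set α : UnitAddCircle := (θ : UnitAddCircle)
  set V := v (l + 2)
  have hV : (0 : ℝ) < V := hv.cast_pos (l + 1)
  have hmod : ‖n • α - (n % V) • α‖ ≤ 1 / (2 * ((l : ℝ) + 2) ^ 2 * V) := by
    have hVθ := hv.mul_distInt_le hτ (Finset.mem_Ico.1 hn).2.le
    rw [distInt_natCast_mul] at hVθ
    calc ‖n • α - (n % V) • α‖ ≤ n / V * ‖V • α‖ := norm_nsmul_sub_mod_nsmul_le α n V
      _ = n * ‖V • α‖ / V := by ring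
      _ ≤ 1 / (2 * ((l : ℝ) + 2) ^ 2) / V := by gcongr
      _ = 1 / (2 * ((l : ℝ) + 2) ^ 2 * V) := div_div _ _ _
  have hsol : ‖n • α - (s : UnitAddCircle)‖ < 1 / (2 * ((l : ℝ) + 2) ^ 2 * V) := by
    rw [← distInt_natCast_mul_sub, ← hψ.eq_on_block hn]
    exact hs.2
  rw [norm_sub_rev] at hmod
  calc ‖(n % V) • α - (s : UnitAddCircle)‖
      ≤ ‖(n % V) • α - n • α‖ + ‖n • α - (s : UnitAddCircle)‖ :=
        norm_sub_le_norm_sub_add_norm_sub ..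
    _ ≤ 1 / (2 * ((l : ℝ) + 2) ^ 2 * V) + 1 / (2 * ((l : ℝ) + 2) ^ 2 * V) :=
        add_le_add hmod hsol.le
    _ = 1 / (((l : ℝ) + 2) ^ 2 * V) := by field_simp; norm_num

theorem ae_finite_solutions (hψ : IsTsengSeq τ v ψ) (hv : IsTsengBase τ θ v) (hτ : 1 ≤ τ) :
    ∀ᵐ s : ℝ, (solutions θ ψ s).Finite := by
  let G : ℕ → Set UnitAddCircle := fun l => ⋃ r ∈ Finset.range (v (l + 2)),
    closedBall (r • (θ : UnitAddCircle)) (1 / (((l : ℝ) + 2) ^ 2 * v (l + 2)))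
  have hG : ∀ l, volume (G l) ≤ ENNReal.ofReal (2 * (1 / ((l : ℝ) + 2) ^ 2)) := fun l => by
    have hV := hv.cast_pos (l + 1)
    calc volume (G l) ≤ ∑ r ∈ Finset.range (v (l + 2)),
          ENNReal.ofReal (2 * (1 / (((l : ℝ) + 2) ^ 2 * v (l + 2)))) :=
          (measure_biUnion_finset_le _ _).trans
            (Finset.sum_le_sum fun r _ => volume_closedBall_le _ _)
      _ = ENNReal.ofReal (2 * (1 / ((l : ℝ) + 2) ^ 2)) := by
          rw [Finset.sum_const, Finset.card_range, ← ENNReal.ofReal_nsmul, nsmul_eq_mul]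
          congr 1
          field_simp
  have hfin : ∑' l, volume (G l) ≠ ⊤ := ne_top_of_le_ne_top
    (summable_one_div_add_two_sq.mul_left 2).tsum_ofReal_ne_top (ENNReal.tsum_le_tsum hG)
  have hu := hv.strictMono_tsengIndex_succ hτ
  obtain ⟨L, -, hL⟩ := exists_monotone_blockIndex hu.monotone hu.tendsto_atTop
  filter_upwards [ae_real_of_ae_circle (ae_eventually_notMem hfin)] with s hs
  obtain ⟨l₀, hl₀⟩ := eventually_atTop.1 hs
  refine (Set.finite_lt_nat (tsengIndex τ v (l₀ + 1))).subset fun n hn => ?_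
  by_contra hlt
  have hn₀ : tsengIndex τ v (l₀ + 1) ≤ n := not_lt.1 hlt
  obtain ⟨hle, hlt'⟩ := (hL n ((hu.monotone l₀.zero_le).trans hn₀) _).1 rfl
  have hl₀n : l₀ ≤ L n := Nat.lt_succ_iff.1 (hu.lt_iff_lt.1 (hn₀.trans_lt hlt'))
  refine hl₀ (L n) hl₀n (Set.mem_iUnion₂.2 ⟨n % v (L n + 2),
    Finset.mem_range.2 (Nat.mod_lt _ (hv.pos _ (Nat.succ_pos _))), ?_⟩)
  rw [mem_closedBall, dist_comm, dist_eq_norm]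
  exact hψ.norm_mod_nsmul_sub_le hv (by linarith) (Finset.mem_Ico.2 ⟨hle, hlt'⟩) hn

end IsTsengSeq

theorem thetaSet_subset_omegaSet (hτ : 1 ≤ τ) : thetaSet τ ⊆ omegaSet τ := by
  intro θ hθ
  by_contra hΩ
  obtain ⟨v, hv⟩ := exists_isTsengBase hΩ
  obtain ⟨ψ, hψ⟩ := hv.exists_isTsengSeq hτ
  obtain ⟨s, hfin, hinf⟩ :=
    ((hψ.ae_finite_solutions hv hτ).and (hθ ψ hψ.approxSeq (hψ.powDiverges hv hτ))).exists
  exact hinf hfin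

end Tseng

section SecondMoment

variable {Ω : Type*} [MeasurableSpace Ω] {μ : Measure Ω}

theorem sq_sum_measure_le {ι : Type*} (S : Finset ι) {E : ι → Set Ω}
    (hE : ∀ i ∈ S, MeasurableSet (E i)) :
    (∑ i ∈ S, μ (E i)) ^ 2 ≤ (∑ i ∈ S, ∑ j ∈ S, μ (E i ∩ E j)) * μ (⋃ i ∈ S, E i) := by
  set U := ⋃ i ∈ S, E i
  let f : Ω → ENNReal := fun x => ∑ i ∈ S, (E i).indicator 1 x
  let g : Ω → ENNReal := U.indicator 1
  have hU : MeasurableSet U := S.measurableSet_biUnion hE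
  have hfm : Measurable f := Finset.measurable_sum S fun i hi => measurable_one.indicator (hE i hi)
  have hgm : Measurable g := measurable_one.indicator hU
  have hfg : f * g = f := by
    funext x
    by_cases hx : x ∈ U
    · simp [g, hx]
    · have hf : f x = 0 := Finset.sum_eq_zero fun i hi =>
        Set.indicator_of_notMem (fun hxi => hx (Set.mem_biUnion hi hxi)) _
      simp [hf]
  have hf₁ : ∫⁻ x, f x ∂μ = ∑ i ∈ S, μ (E i) := by
    rw [lintegral_finsetSum' S fun i hi => (measurable_one.indicator (hE i hi)).aemeasurable]
    exact Finset.sum_congr rfl fun i hi => lintegral_indicator_one (hE i hi)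
  have hf₂ : ∫⁻ x, f x ^ (2 : ℝ) ∂μ = ∑ i ∈ S, ∑ j ∈ S, μ (E i ∩ E j) := by
    have hsq : ∀ x, f x ^ (2 : ℝ) = ∑ i ∈ S, ∑ j ∈ S, (E i ∩ E j).indicator 1 x := fun x => by
      rw [ENNReal.rpow_two, sq, Finset.sum_mul_sum]
      simp only [Set.inter_indicator_one, Pi.mul_apply]
    simp only [hsq]
    rw [lintegral_finsetSum' S fun i hi => (Finset.measurable_sum S fun j hj =>
      measurable_one.indicator ((hE i hi).inter (hE j hj))).aemeasurable]
    refine Finset.sum_congr rfl fun i hi => ?_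
    rw [lintegral_finsetSum' S fun j hj =>
      (measurable_one.indicator ((hE i hi).inter (hE j hj))).aemeasurable]
    exact Finset.sum_congr rfl fun j hj => lintegral_indicator_one ((hE i hi).inter (hE j hj))
  have hg₂ : ∫⁻ x, g x ^ (2 : ℝ) ∂μ = μ U := by
    have hsq : ∀ x, g x ^ (2 : ℝ) = g x := fun x => by
      by_cases hx : x ∈ U <;> simp [g, hx]
    simp only [hsq]
    exact lintegral_indicator_one hU
  have hCS := ENNReal.lintegral_mul_le_Lp_mul_Lq μ Real.HolderConjugate.two_two
    hfm.aemeasurable hgm.aemeasurable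
  rw [hfg, hf₁, hf₂, hg₂, ← ENNReal.mul_rpow_of_nonneg _ _ (by norm_num)] at hCS
  calc _ ≤ _ := pow_le_pow_left' hCS 2
    _ = _ := by rw [← ENNReal.rpow_two, ← ENNReal.rpow_mul]; norm_num

theorem sq_sum_measureReal_le [IsFiniteMeasure μ] {ι : Type*} (S : Finset ι) {E : ι → Set Ω}
    (hE : ∀ i ∈ S, MeasurableSet (E i)) :
    (∑ i ∈ S, μ.real (E i)) ^ 2 ≤
      (∑ i ∈ S, ∑ j ∈ S, μ.real (E i ∩ E j)) * μ.real (⋃ i ∈ S, E i) := by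
  have hfin : (∑ i ∈ S, ∑ j ∈ S, μ (E i ∩ E j)) * μ (⋃ i ∈ S, E i) ≠ ⊤ :=
    ENNReal.mul_ne_top (ENNReal.sum_ne_top.2 fun i _ => ENNReal.sum_ne_top.2 fun j _ =>
      measure_ne_top _ _) (measure_ne_top _ _)
  simpa [measureReal_def, ENNReal.toReal_sum, ENNReal.sum_ne_top] using
    ENNReal.toReal_mono hfin (sq_sum_measure_le S hE)

theorem le_measure_limsup_of_forall_le [IsFiniteMeasure μ] {E : ℕ → Set Ω}
    (hE : ∀ l, MeasurableSet (E l)) {c : ENNReal} (hc : ∀ m, c ≤ μ (⋃ l ≥ m, E l)) :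
    c ≤ μ (limsup E atTop) := by
  rw [limsup_eq_iInf_iSup_of_nat]
  simp only [Set.iInf_eq_iInter, Set.iSup_eq_iUnion]
  exact ge_of_tendsto' (tendsto_measure_iInter_atTop
    (fun m => (MeasurableSet.biUnion (Set.to_countable _) fun l _ => hE l).nullMeasurableSet)
    (fun a b hab => Set.biUnion_mono (fun l hl => le_trans hab hl) fun _ _ => subset_rfl)
    ⟨0, measure_ne_top _ _⟩) hc

theorem le_measure_limsup_of_frequently_le [IsFiniteMeasure μ] {E : ℕ → Set Ω}
    (hE : ∀ l, MeasurableSet (E l)) {c : ENNReal} (hc : ∃ᶠ l in atTop, c ≤ μ (E l)) :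
    c ≤ μ (limsup E atTop) :=
  le_measure_limsup_of_forall_le hE fun m => by
    obtain ⟨l, hml, hl⟩ := frequently_atTop.1 hc m
    exact hl.trans (measure_mono (Set.subset_biUnion_of_mem (u := E) hml))

theorem sum_sum_Ico_le_of_sum_le {a : ℕ → ℝ} {b : ℕ → ℕ → ℝ} {C : ℝ} {m : ℕ}
    (hsymm : ∀ k l, b k l = b l k) (hdiag : ∀ l, b l l = a l) (ha : ∀ l, 0 ≤ a l) (hC : 0 ≤ C)
    (hb : ∀ l, ∑ k ∈ Finset.Ico m l, b k l ≤ C * a l * (∑ k ∈ Finset.Ico m l, a k + 1)) (d : ℕ) :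
    ∑ k ∈ Finset.Ico m (m + d), ∑ l ∈ Finset.Ico m (m + d), b k l ≤
      ∑ l ∈ Finset.Ico m (m + d), a l + 2 * C * (∑ l ∈ Finset.Ico m (m + d), a l) *
        (∑ l ∈ Finset.Ico m (m + d), a l + 1) := by
  induction d with
  | zero => simp
  | succ d ih =>
    rw [← Nat.add_assoc]
    simp only [Finset.sum_Ico_succ_top (Nat.le_add_right m d), Finset.sum_add_distrib, hdiag,
      hsymm (m + d)]
    have hs : 0 ≤ ∑ l ∈ Finset.Ico m (m + d), a l := Finset.sum_nonneg fun l _ => ha l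
    have hcross := mul_nonneg hC (mul_nonneg hs (ha (m + d)))
    have hsq := mul_nonneg hC (mul_nonneg (ha (m + d)) (ha (m + d)))
    nlinarith [hb (m + d)]

theorem le_measureReal_biUnion_of_quasiIndependent [IsFiniteMeasure μ] {E : ℕ → Set Ω}
    (hE : ∀ l, MeasurableSet (E l)) {C : ℝ} (hC : 0 ≤ C) {m d : ℕ}
    (hpair : ∀ l, ∑ k ∈ Finset.Ico m l, μ.real (E k ∩ E l) ≤
      C * μ.real (E l) * (∑ k ∈ Finset.Ico m l, μ.real (E k) + 1))
    (hone : 1 ≤ ∑ l ∈ Finset.Ico m (m + d), μ.real (E l)) :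
    1 / (1 + 4 * C) ≤ μ.real (⋃ l ∈ Finset.Ico m (m + d), E l) := by
  have hCS := sq_sum_measureReal_le (μ := μ) (Finset.Ico m (m + d)) fun l _ => hE l
  have hpairs := sum_sum_Ico_le_of_sum_le (fun k l => by rw [Set.inter_comm])
    (fun l => by rw [Set.inter_self]) (fun l => measureReal_nonneg) hC hpair d
  set s := ∑ l ∈ Finset.Ico m (m + d), μ.real (E l)
  have hs : 0 ≤ C * (s * (s - 1)) := by
    have : 0 ≤ s - 1 := by linarith
    positivity
  have hbound : ∑ k ∈ Finset.Ico m (m + d), ∑ l ∈ Finset.Ico m (m + d), μ.real (E k ∩ E l) ≤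
      (1 + 4 * C) * s ^ 2 := by nlinarith
  rw [div_le_iff₀' (by positivity)]
  refine le_of_mul_le_mul_left ?_ (by positivity : 0 < s ^ 2)
  calc s ^ 2 * 1 = s ^ 2 := mul_one _
    _ ≤ (1 + 4 * C) * s ^ 2 * μ.real (⋃ l ∈ Finset.Ico m (m + d), E l) :=
      hCS.trans (by gcongr)
    _ = _ := by ring

/- The converse part of the Borel–Cantelli lemma, for events that are independent only up to a
constant; the limsup then need not have full measure. -/
theorem measure_limsup_pos_of_quasiIndependent [IsFiniteMeasure μ] {E : ℕ → Set Ω}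
    (hE : ∀ l, MeasurableSet (E l)) {C : ℝ} (hC : 0 ≤ C)
    (hdiv : ¬ Summable fun l => μ.real (E l))
    (hpair : ∀ m l, ∑ k ∈ Finset.Ico m l, μ.real (E k ∩ E l) ≤
      C * μ.real (E l) * (∑ k ∈ Finset.Ico m l, μ.real (E k) + 1)) :
    0 < μ (limsup E atTop) := by
  have hone : ∀ m, ∃ d, 1 ≤ ∑ l ∈ Finset.Ico m (m + d), μ.real (E l) := fun m => by
    rw [← summable_nat_add_iff m,
      not_summable_iff_tendsto_nat_atTop_of_nonneg fun _ => measureReal_nonneg] at hdiv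
    obtain ⟨d, hd⟩ := (hdiv.eventually_ge_atTop 1).exists
    refine ⟨d, hd.trans_eq ?_⟩
    rw [Finset.sum_Ico_eq_sum_range, Nat.add_sub_cancel_left]
    simp only [add_comm]
  have hpos : (0 : ENNReal) < ENNReal.ofReal (1 / (1 + 4 * C)) :=
    ENNReal.ofReal_pos.2 (by positivity)
  refine hpos.trans_le (le_measure_limsup_of_forall_le hE fun m => ?_)
  obtain ⟨d, hd⟩ := hone m
  rw [ENNReal.ofReal_le_iff_le_toReal (measure_ne_top _ _)]
  refine (le_measureReal_biUnion_of_quasiIndependent hE hC (hpair m) hd).trans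
    (measureReal_mono (Set.biUnion_mono (fun l hl => ?_) fun _ _ => subset_rfl)
      (measure_ne_top _ _))
  exact (Finset.mem_Ico.1 hl).1

end SecondMoment

section Balls

theorem measureReal_ball (x : UnitAddCircle) {r : ℝ} (hr : 0 ≤ r) (hr' : 2 * r ≤ 1) :
    volume.real (ball x r) = 2 * r := by
  rcases hr.eq_or_lt with rfl | hr
  · simp
  · rw [← measureReal_congr AddCircle.closedBall_ae_eq_ball, measureReal_def,
      AddCircle.volume_closedBall, min_eq_right hr', ENNReal.toReal_ofReal (by positivity)]

theorem measureReal_biUnion_ball {ι : Type*} (S : Finset ι) {x : ι → UnitAddCircle} {r : ι → ℝ}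
    (hr : ∀ i ∈ S, 0 ≤ r i) (hr' : ∀ i ∈ S, 2 * r i ≤ 1)
    (hsep : ∀ i ∈ S, ∀ j ∈ S, i ≠ j → r i + r j ≤ ‖x i - x j‖) :
    volume.real (⋃ i ∈ S, ball (x i) (r i)) = ∑ i ∈ S, 2 * r i := by
  rw [measureReal_biUnion_finset (fun i hi j hj hij => ball_disjoint_ball ?_)
    fun i _ => measurableSet_ball]
  · exact Finset.sum_congr rfl fun i hi => measureReal_ball _ (hr i hi) (hr' i hi)
  · rw [dist_eq_norm]
    exact hsep i hi j hj hij

theorem card_mul_le_of_separated {ι : Type*} (S : Finset ι) {x : ι → UnitAddCircle}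
    {y : UnitAddCircle} {d ρ : ℝ} (hd : 0 ≤ d) (hd' : d ≤ 1) (hρ : 0 ≤ ρ)
    (hsep : ∀ i ∈ S, ∀ j ∈ S, i ≠ j → d ≤ ‖x i - x j‖) (hy : ∀ i ∈ S, ‖x i - y‖ ≤ ρ) :
    S.card * d ≤ 2 * ρ + d := by
  have hunion : volume.real (⋃ i ∈ S, ball (x i) (d / 2)) = S.card * d := by
    rw [measureReal_biUnion_ball S (fun _ _ => by positivity) (fun _ _ => by linarith)
      fun i hi j hj hij => by rw [add_halves]; exact hsep i hi j hj hij]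
    simp only [mul_div_cancel₀ _ (two_ne_zero' ℝ), Finset.sum_const, nsmul_eq_mul]
  have hsub : ⋃ i ∈ S, ball (x i) (d / 2) ⊆ closedBall y (ρ + d / 2) :=
    Set.iUnion₂_subset fun i hi => ball_subset_closedBall.trans <|
      closedBall_subset_closedBall' <| by rw [dist_eq_norm]; linarith [hy i hi]
  calc S.card * d ≤ volume.real (closedBall y (ρ + d / 2)) :=
      hunion.symm.trans_le (measureReal_mono hsub (measure_ne_top _ _))
    _ ≤ 2 * (ρ + d / 2) :=
      ENNReal.toReal_le_of_le_ofReal (by positivity) (volume_closedBall_le _ _)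
    _ = 2 * ρ + d := by ring

theorem measureReal_ball_inter_biUnion_ball_le {ι : Type*} (S : Finset ι)
    {x : ι → UnitAddCircle} {y : UnitAddCircle} {d r ρ : ℝ} (hd : 0 < d) (hd' : d ≤ 1)
    (hr : 0 ≤ r) (hrd : 2 * r ≤ d) (hρ : 0 ≤ ρ)
    (hsep : ∀ i ∈ S, ∀ j ∈ S, i ≠ j → d ≤ ‖x i - x j‖) :
    volume.real (ball y ρ ∩ ⋃ i ∈ S, ball (x i) r) ≤ (2 * ρ / d + 2) * (2 * r) := by
  classical
  let T := S.filter fun i => ‖x i - y‖ ≤ ρ + r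
  have hsub : ball y ρ ∩ ⋃ i ∈ S, ball (x i) r ⊆ ⋃ i ∈ T, ball (x i) r := by
    rintro z ⟨hzy, hz⟩
    obtain ⟨i, hi, hzi⟩ := Set.mem_iUnion₂.1 hz
    refine Set.mem_biUnion (Finset.mem_filter.2 ⟨hi, ?_⟩) hzi
    rw [← dist_eq_norm]
    linarith [dist_triangle_left (x i) y z, mem_ball.1 hzy, mem_ball.1 hzi]
  have hcard : (T.card : ℝ) ≤ 2 * ρ / d + 2 := by
    have hT := card_mul_le_of_separated T hd.le hd' (add_nonneg hρ hr)
      (fun i hi j hj => hsep i (Finset.mem_filter.1 hi).1 j (Finset.mem_filter.1 hj).1)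
      fun i hi => (Finset.mem_filter.1 hi).2
    rw [div_add' _ _ _ hd.ne', le_div_iff₀ hd]
    linarith
  calc _ ≤ volume.real (⋃ i ∈ T, ball (x i) r) := measureReal_mono hsub (measure_ne_top _ _)
    _ ≤ ∑ i ∈ T, volume.real (ball (x i) r) := measureReal_biUnion_finset_le _ _
    _ = T.card * (2 * r) := by
      simp only [measureReal_ball _ hr (hrd.trans hd'), Finset.sum_const, nsmul_eq_mul]
    _ ≤ (2 * ρ / d + 2) * (2 * r) := by gcongr

theorem le_norm_nsmul_sub_nsmul {E : Type*} [SeminormedAddCommGroup E] {α : E} {d : ℝ} {N : ℕ}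
    (hα : ∀ n, 1 ≤ n → n < N → d ≤ ‖n • α‖) {m n : ℕ} (hmn : m ≠ n) (hm : m < n + N)
    (hn : n < m + N) : d ≤ ‖m • α - n • α‖ := by
  wlog h : n < m generalizing m n
  · rw [norm_sub_rev]
    exact this hmn.symm hn hm (by omega)
  rw [sub_eq_add_neg, ← sub_nsmul _ h.le]
  exact hα _ (by omega) (by omega)

end Balls

section Runs

/-- The union of the balls around `α, 2α, …, (a q)α`, where the `j`-th run of `q` consecutive
multiples, counted from `j = 0`, gets the common radius `r j`. -/
def runUnion (α : UnitAddCircle) (q a : ℕ) (r : ℕ → ℝ) : Set UnitAddCircle :=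
  ⋃ n ∈ Finset.range (a * q), ball ((n + 1) • α) (r (n / q))

theorem sum_range_mul_div {M : Type*} [AddCommMonoid M] (f : ℕ → M) {q : ℕ} (hq : 0 < q) (a : ℕ) :
    ∑ n ∈ Finset.range (a * q), f (n / q) = q • ∑ j ∈ Finset.range a, f j := by
  induction a with
  | zero => simp
  | succ a ih =>
    rw [Nat.succ_mul, Finset.sum_range_add, ih, Finset.sum_range_succ, nsmul_add]
    congr 1
    refine (Finset.sum_congr rfl fun i hi => ?_).trans
      ((Finset.sum_const (f a)).trans (by rw [Finset.card_range]))
    rw [mul_comm, Nat.mul_add_div hq, Nat.div_eq_of_lt (Finset.mem_range.1 hi), add_zero]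

theorem measurableSet_runUnion (α : UnitAddCircle) (q a : ℕ) (r : ℕ → ℝ) :
    MeasurableSet (runUnion α q a r) :=
  Finset.measurableSet_biUnion _ fun _ _ => measurableSet_ball

variable {α : UnitAddCircle} {q a : ℕ} {r : ℕ → ℝ} {d : ℝ}

theorem measureReal_runUnion (hd : d ≤ 1) (hr : ∀ j, 0 ≤ r j) (hrd : ∀ j, 2 * r j ≤ d)
    (hα : ∀ n, 1 ≤ n → n < a * q → d ≤ ‖n • α‖) :
    volume.real (runUnion α q a r) = ∑ n ∈ Finset.range (a * q), 2 * r (n / q) := by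
  refine measureReal_biUnion_ball _ (fun _ _ => hr _) (fun _ _ => (hrd _).trans hd)
    fun i hi j hj hij => ?_
  rw [Finset.mem_range] at hi hj
  linarith [hrd (i / q), hrd (j / q), le_norm_nsmul_sub_nsmul hα (m := i + 1) (n := j + 1)
    (by omega) (by omega) (by omega)]

theorem measureReal_ball_inter_runUnion_le (hq : 0 < q) (hd : 0 < d) (hd' : d ≤ 1)
    (hr : ∀ j, 0 ≤ r j) (hrd : ∀ j, 2 * r j ≤ d) (hα : ∀ n, 1 ≤ n → n < q → d ≤ ‖n • α‖)
    (x : UnitAddCircle) {ρ : ℝ} (hρ : 0 ≤ ρ) :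
    volume.real (ball x ρ ∩ runUnion α q a r) ≤
      (2 * ρ / d + 2) * ∑ j ∈ Finset.range a, 2 * r j := by
  have hsub : ball x ρ ∩ runUnion α q a r ⊆ ⋃ j ∈ Finset.range a,
      ball x ρ ∩ ⋃ i ∈ Finset.range q, ball ((q * j + i + 1) • α) (r j) := by
    rintro z ⟨hzx, hz⟩
    obtain ⟨n, hn, hzn⟩ := Set.mem_iUnion₂.1 hz
    have hj : n / q < a := Nat.div_lt_of_lt_mul (mul_comm q a ▸ Finset.mem_range.1 hn)
    simp only [Set.mem_iUnion, Set.mem_inter_iff, Finset.mem_range, exists_prop]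
    exact ⟨n / q, hj, hzx, n % q, n.mod_lt hq, by rwa [Nat.div_add_mod]⟩
  calc _ ≤ _ := measureReal_mono hsub (measure_ne_top _ _)
    _ ≤ _ := measureReal_biUnion_finset_le _ _
    _ ≤ ∑ j ∈ Finset.range a, (2 * ρ / d + 2) * (2 * r j) := Finset.sum_le_sum fun j _ =>
      measureReal_ball_inter_biUnion_ball_le _ hd hd' (hr j) (hrd j) hρ fun i hi k hk hik => by
        rw [Finset.mem_range] at hi hk
        exact le_norm_nsmul_sub_nsmul hα (by omega) (by omega) (by omega)
    _ = _ := (Finset.mul_sum _ _ _).symm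

theorem measureReal_biUnion_ball_inter_runUnion_le (hq : 0 < q) (hd : 0 < d) (hd' : d ≤ 1)
    (hr : ∀ j, 0 ≤ r j) (hrd : ∀ j, 2 * r j ≤ d) (hα : ∀ n, 1 ≤ n → n < q → d ≤ ‖n • α‖)
    {ι : Type*} (S : Finset ι) {x : ι → UnitAddCircle} {ρ : ι → ℝ} (hρ : ∀ i ∈ S, 0 ≤ ρ i) :
    volume.real ((⋃ i ∈ S, ball (x i) (ρ i)) ∩ runUnion α q a r) ≤
      ((∑ i ∈ S, 2 * ρ i) / d + 2 * S.card) * ∑ j ∈ Finset.range a, 2 * r j := by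
  rw [Set.iUnion₂_inter]
  calc _ ≤ _ := measureReal_biUnion_finset_le _ _
    _ ≤ ∑ i ∈ S, (2 * ρ i / d + 2) * ∑ j ∈ Finset.range a, 2 * r j :=
      Finset.sum_le_sum fun i hi =>
        measureReal_ball_inter_runUnion_le hq hd hd' hr hrd hα (x i) (hρ i hi)
    _ = _ := by
      rw [← Finset.sum_mul, Finset.sum_add_distrib, Finset.sum_div, Finset.sum_const,
        nsmul_eq_mul, mul_comm (2 : ℝ)]

end Runs

section BlockSets

variable {θ : ℝ} {ψ : ℕ → ℝ}

theorem sum_range_succ_le_four_mul {u : ℕ → ℕ} (hu : Monotone u)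
    (hu₂ : ∀ k, 2 * u k ≤ u (k + 2)) (l : ℕ) : ∑ k ∈ Finset.range (l + 1), u k ≤ 4 * u l := by
  induction l using Nat.twoStepInduction with
  | zero =>
    rw [zero_add, Finset.sum_range_one]
    omega
  | one =>
    have := hu zero_le_one
    rw [Finset.sum_range_succ, Finset.sum_range_one]
    omega
  | more l ih _ =>
    have := hu₂ l
    have : u (l + 1) ≤ u (l + 2) := hu (Nat.le_succ _)
    rw [Finset.sum_range_succ, Finset.sum_range_succ]
    omega

theorem one_div_le_norm_nsmul (hθ : Irrational θ) {k n : ℕ} (hn : 1 ≤ n)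
    (hnk : n < convDenom θ (k + 1)) :
    1 / (2 * convDenom θ (k + 1)) ≤ ‖n • (θ : UnitAddCircle)‖ :=
  distInt_natCast_mul n θ ▸ one_div_le_distInt hθ hn hnk

theorem one_div_two_mul_convDenom_le_one (θ : ℝ) (k : ℕ) :
    (1 : ℝ) / (2 * convDenom θ k) ≤ 1 := by
  have : (1 : ℝ) ≤ convDenom θ k := Nat.one_le_cast.2 (convDenom_pos θ k)
  rw [div_le_one (by positivity)]
  linarith

/-- The radius of the balls around the `j`-th run of `q_l` consecutive multiples of `θ`: at most
`ψ` at every index of the run, and small enough for the balls around the first `q_{l+1}` multiples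
to be disjoint. -/
noncomputable def blockRadius (θ : ℝ) (ψ : ℕ → ℝ) (l j : ℕ) : ℝ :=
  min (ψ ((j + 1) * convDenom θ l)) (1 / (4 * convDenom θ (l + 1)))

/-- The union of the balls of radius `blockRadius θ ψ l j` around the first `⌊q_{l+1} / q_l⌋` runs
of `q_l` consecutive multiples of `θ`. -/
noncomputable def blockSet (θ : ℝ) (ψ : ℕ → ℝ) (l : ℕ) : Set UnitAddCircle :=
  runUnion θ (convDenom θ l) (convDenom θ (l + 1) / convDenom θ l) (blockRadius θ ψ l)

theorem blockRadius_nonneg (θ : ℝ) (hψ : IsApproxSeq ψ) (l j : ℕ) : 0 ≤ blockRadius θ ψ l j :=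
  le_min (hψ.pos _ (Nat.mul_pos j.succ_pos (convDenom_pos θ l))).le (by positivity)

theorem two_mul_blockRadius_le (θ : ℝ) (ψ : ℕ → ℝ) (l j : ℕ) :
    2 * blockRadius θ ψ l j ≤ 1 / (2 * convDenom θ (l + 1)) := by
  have := convDenom_cast_pos θ (l + 1)
  calc _ ≤ 2 * (1 / (4 * (convDenom θ (l + 1) : ℝ))) := by
        gcongr
        exact min_le_right _ _
    _ = _ := by field_simp; norm_num

theorem measureReal_blockSet (hθ : Irrational θ) (hψ : IsApproxSeq ψ) (l : ℕ) :
    volume.real (blockSet θ ψ l) =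
      ∑ n ∈ Finset.range (convDenom θ (l + 1) / convDenom θ l * convDenom θ l),
        2 * blockRadius θ ψ l (n / convDenom θ l) :=
  measureReal_runUnion (one_div_two_mul_convDenom_le_one θ (l + 1)) (blockRadius_nonneg θ hψ l)
    (two_mul_blockRadius_le θ ψ l) fun _ hn hnq =>
      one_div_le_norm_nsmul hθ hn (hnq.trans_le (Nat.div_mul_le_self _ _))

theorem measureReal_blockSet_inter_le (hθ : Irrational θ) (hψ : IsApproxSeq ψ) {k l : ℕ}
    (hkl : k < l) :
    volume.real (blockSet θ ψ k ∩ blockSet θ ψ l) ≤ volume.real (blockSet θ ψ l) *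
      (2 * volume.real (blockSet θ ψ k) + 2 * (convDenom θ (k + 1) / convDenom θ l)) := by
  have hq := convDenom_cast_pos θ l
  have hsep : ∀ n, 1 ≤ n → n < convDenom θ l →
      1 / (2 * (convDenom θ l : ℝ)) ≤ ‖n • (θ : UnitAddCircle)‖ := by
    obtain ⟨l, rfl⟩ := Nat.exists_eq_succ_of_ne_zero (Nat.ne_zero_of_lt hkl)
    exact fun n => one_div_le_norm_nsmul hθ
  have hmono : 1 / (2 * (convDenom θ (l + 1) : ℝ)) ≤ 1 / (2 * convDenom θ l) := by
    gcongr
    exact convDenom_mono θ l.le_succ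
  have hinter := measureReal_biUnion_ball_inter_runUnion_le
    (a := convDenom θ (l + 1) / convDenom θ l) (x := fun n => (n + 1) • (θ : UnitAddCircle))
    (convDenom_pos θ l) (by positivity) (one_div_two_mul_convDenom_le_one θ l)
    (blockRadius_nonneg θ hψ l) (fun j => (two_mul_blockRadius_le θ ψ l j).trans hmono) hsep
    (Finset.range (convDenom θ (k + 1) / convDenom θ k * convDenom θ k))
    fun n _ => blockRadius_nonneg θ hψ k (n / convDenom θ k)
  rw [← measureReal_blockSet hθ hψ, Finset.card_range] at hinter
  have hcard : ((convDenom θ (k + 1) / convDenom θ k * convDenom θ k : ℕ) : ℝ) ≤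
      convDenom θ (k + 1) := Nat.cast_le.2 (Nat.div_mul_le_self _ _)
  have hnonneg : 0 ≤
      ∑ j ∈ Finset.range (convDenom θ (l + 1) / convDenom θ l), 2 * blockRadius θ ψ l j :=
    Finset.sum_nonneg fun j _ => mul_nonneg zero_le_two (blockRadius_nonneg θ hψ l j)
  rw [measureReal_blockSet hθ hψ l,
    sum_range_mul_div (fun j => 2 * blockRadius θ ψ l j) (convDenom_pos θ l), nsmul_eq_mul]
  calc _ ≤ _ := hinter
    _ ≤ (volume.real (blockSet θ ψ k) / (1 / (2 * convDenom θ l)) + 2 * convDenom θ (k + 1)) *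
        ∑ j ∈ Finset.range (convDenom θ (l + 1) / convDenom θ l), 2 * blockRadius θ ψ l j := by
      gcongr
    _ = _ := by field_simp

theorem volume_limsup_blockSet_pos (hθ : Irrational θ) (hψ : IsApproxSeq ψ)
    (hdiv : ¬ Summable fun l => volume.real (blockSet θ ψ l)) :
    0 < volume (limsup (blockSet θ ψ) atTop) := by
  refine measure_limsup_pos_of_quasiIndependent (fun l => measurableSet_runUnion _ _ _ _)
    (by norm_num : (0 : ℝ) ≤ 8) hdiv fun m l => ?_
  have hratio : ∑ k ∈ Finset.Ico m l, ((convDenom θ (k + 1) : ℝ) / convDenom θ l) ≤ 4 := by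
    rw [← Finset.sum_div, div_le_iff₀ (convDenom_cast_pos θ l)]
    have hsum : ∑ k ∈ Finset.Ico m l, convDenom θ (k + 1) ≤ 4 * convDenom θ l := by
      refine le_trans ?_
        (sum_range_succ_le_four_mul (convDenom_mono θ) (two_mul_convDenom_le hθ) l)
      rw [Finset.sum_range_succ']
      refine (Finset.sum_le_sum_of_subset fun k hk => ?_).trans (Nat.le_add_right _ _)
      exact Finset.mem_range.2 (Finset.mem_Ico.1 hk).2
    exact_mod_cast hsum
  have hs : 0 ≤ ∑ k ∈ Finset.Ico m l, volume.real (blockSet θ ψ k) :=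
    Finset.sum_nonneg fun _ _ => measureReal_nonneg
  calc _ ≤ ∑ k ∈ Finset.Ico m l, volume.real (blockSet θ ψ l) *
        (2 * volume.real (blockSet θ ψ k) + 2 * (convDenom θ (k + 1) / convDenom θ l)) :=
        Finset.sum_le_sum fun k hk =>
          measureReal_blockSet_inter_le hθ hψ (Finset.mem_Ico.1 hk).2
    _ = volume.real (blockSet θ ψ l) * (2 * ∑ k ∈ Finset.Ico m l, volume.real (blockSet θ ψ k)
        + 2 * ∑ k ∈ Finset.Ico m l, ((convDenom θ (k + 1) : ℝ) / convDenom θ l)) := by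
        rw [← Finset.mul_sum, Finset.sum_add_distrib, Finset.mul_sum, Finset.mul_sum]
    _ ≤ volume.real (blockSet θ ψ l) *
        (8 * (∑ k ∈ Finset.Ico m l, volume.real (blockSet θ ψ k) + 1)) := by
        gcongr
        linarith
    _ = _ := by ring

theorem rpow_le_mul_blockRadius {τ c : ℝ} (hτ : 1 ≤ τ) (hc : 0 < c) (hθ : Irrational θ)
    (hΩ : ∀ n : ℕ, 1 ≤ n → c / (n : ℝ) ^ τ ≤ distInt (n * θ)) (hψ : IsApproxSeq ψ) {l : ℕ}
    (hl : ψ (convDenom θ l) ≤ 1 / (4 * convDenom θ l)) (j : ℕ) :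
    ψ ((j + 1) * convDenom θ l) ^ τ ≤ (1 + 4 / c) * blockRadius θ ψ l j := by
  have hq := convDenom_cast_pos θ l
  have hq' := convDenom_cast_pos θ (l + 1)
  have hq₁ : (1 : ℝ) ≤ convDenom θ l := Nat.one_le_cast.2 (convDenom_pos θ l)
  have hx₀ : 0 < ψ ((j + 1) * convDenom θ l) :=
    hψ.pos _ (Nat.mul_pos j.succ_pos (convDenom_pos θ l))
  have hx : ψ ((j + 1) * convDenom θ l) ≤ 1 / convDenom θ l :=
    (hψ.anti _ _ (convDenom_pos θ l) (Nat.le_mul_of_pos_left _ j.succ_pos)).trans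
      (hl.trans (by gcongr; linarith))
  have hx₁ := hx.trans (div_le_one_of_le₀ hq₁ hq.le)
  rw [blockRadius]
  set x := ψ ((j + 1) * convDenom θ l)
  rw [mul_min_of_nonneg _ _ (by positivity)]
  refine le_min ?_ ?_
  · calc x ^ τ ≤ x ^ (1 : ℝ) := Real.rpow_le_rpow_of_exponent_ge hx₀ hx₁ hτ
      _ = x := Real.rpow_one x
      _ ≤ (1 + 4 / c) * x := le_mul_of_one_le_left hx₀.le (le_add_of_nonneg_right (by positivity))
  · have hqτ := (hΩ _ (convDenom_pos θ l)).trans (distInt_convDenom_mul_le hθ l)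
    calc x ^ τ ≤ (1 / (convDenom θ l : ℝ)) ^ τ := Real.rpow_le_rpow hx₀.le hx (by linarith)
      _ = 1 / c * (c / (convDenom θ l : ℝ) ^ τ) := by
          rw [Real.div_rpow zero_le_one hq.le, Real.one_rpow]; field_simp
      _ ≤ 1 / c * (1 / convDenom θ (l + 1)) := by gcongr
      _ = 4 / c * (1 / (4 * convDenom θ (l + 1))) := by field_simp
      _ ≤ (1 + 4 / c) * (1 / (4 * convDenom θ (l + 1))) := by gcongr; linarith

theorem sum_Ico_le_sum_range_mul_div {f : ℕ → ℝ} {q : ℕ} (hq : 0 < q)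
    (hf₀ : ∀ n, q ≤ n → 0 ≤ f n) (hf : AntitoneOn f (Set.Ici q)) (Q : ℕ) :
    ∑ n ∈ Finset.Ico q Q, f n ≤ ∑ n ∈ Finset.range (Q / q * q), f ((n / q + 1) * q) := by
  have hqn : ∀ n, q ≤ (n / q + 1) * q := fun n => Nat.le_mul_of_pos_left _ (Nat.succ_pos _)
  have hrange : Q - q ≤ Q / q * q := by
    have := Nat.lt_div_mul_add (a := Q) hq
    omega
  rw [Finset.sum_Ico_eq_sum_range]
  calc _ ≤ ∑ n ∈ Finset.range (Q - q), f ((n / q + 1) * q) :=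
        Finset.sum_le_sum fun n _ => hf (hqn n) (Set.mem_Ici.2 (Nat.le_add_right q n)) <| by
          have := Nat.div_mul_le_self n q
          rw [add_one_mul]
          omega
    _ ≤ _ := Finset.sum_le_sum_of_subset_of_nonneg (Finset.range_subset_range.2 hrange)
        fun n _ _ => hf₀ _ (hqn n)

theorem not_summable_measureReal_blockSet {τ : ℝ} (hτ : 1 ≤ τ) (hθ : Irrational θ)
    (hΩ : θ ∈ omegaSet τ) (hψ : IsApproxSeq ψ) (hdiv : PowDiverges τ ψ)
    (hsmall : ∀ᶠ l in atTop, ψ (convDenom θ l) ≤ 1 / (4 * convDenom θ l)) :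
    ¬ Summable fun l => volume.real (blockSet θ ψ l) := by
  obtain ⟨c, hc, hΩ⟩ := hΩ
  have hf₀ : ∀ n, 1 ≤ n → 0 ≤ ψ n ^ τ := fun n hn => Real.rpow_nonneg (hψ.pos n hn).le τ
  have hblock : ∀ᶠ l in atTop, ∑ n ∈ Finset.Ico (convDenom θ l) (convDenom θ (l + 1)), ψ n ^ τ ≤
      (1 + 4 / c) / 2 * volume.real (blockSet θ ψ l) := by
    filter_upwards [hsmall] with l hl
    calc _ ≤ _ := sum_Ico_le_sum_range_mul_div (convDenom_pos θ l)
          (fun n hn => hf₀ n ((convDenom_pos θ l).trans_le hn))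
          (fun m hm n _ hmn => Real.rpow_le_rpow
            (hψ.pos n ((convDenom_pos θ l).trans_le (hm.trans hmn))).le
            (hψ.anti m n ((convDenom_pos θ l).trans_le hm) hmn) (by linarith)) _
      _ ≤ _ := Finset.sum_le_sum fun n _ => rpow_le_mul_blockRadius hτ hc hθ hΩ hψ hl _
      _ = _ := by
        rw [measureReal_blockSet hθ hψ, Finset.mul_sum]
        exact Finset.sum_congr rfl fun n _ => by ring
  intro hsum
  refine hdiv ((summable_nat_add_iff (f := fun n => ψ n ^ τ) 1).2 ?_)
  rw [← summable_sum_Ico_iff (convDenom_mono θ) (tendsto_convDenom hθ)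
    (by rwa [convDenom_zero])]
  refine Summable.of_norm_bounded_eventually_nat (hsum.mul_left ((1 + 4 / c) / 2)) ?_
  filter_upwards [hblock] with l hl
  rwa [Real.norm_of_nonneg (Finset.sum_nonneg fun n hn =>
    hf₀ n ((convDenom_pos θ l).trans_le (Finset.mem_Ico.1 hn).1))]

end BlockSets

section Approximable

variable {α : UnitAddCircle} {ψ : ℕ → ℝ}

/-- The points of the circle that lie within `ψ n` of `n α` for infinitely many `n`. -/
def approxLimsup (α : UnitAddCircle) (ψ : ℕ → ℝ) : Set UnitAddCircle :=
  limsup (fun n => ball (n • α) (ψ n)) atTop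

/-- The points of the circle that lie within both `ψ n` and `ρ` of `n α` for some `n ≥ 1`. -/
def closeApprox (α : UnitAddCircle) (ψ : ℕ → ℝ) (ρ : ℝ) : Set UnitAddCircle :=
  ⋃ n ≥ 1, ball (n • α) (min (ψ n) ρ)

theorem mem_approxLimsup {x : UnitAddCircle} :
    x ∈ approxLimsup α ψ ↔ ∃ᶠ n in atTop, x ∈ ball (n • α) (ψ n) :=
  mem_limsup_iff_frequently_mem

theorem approxLimsup_subset_preimage_add_neg (hψ : AntitoneOn ψ (Set.Ici 1)) :
    approxLimsup α ψ ⊆ (fun x => x + -α) ⁻¹' approxLimsup α ψ := by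
  intro x hx
  rw [Set.mem_preimage, mem_approxLimsup, frequently_atTop]
  intro N
  obtain ⟨n, hn, hxn⟩ := frequently_atTop.1 (mem_approxLimsup.1 hx) (N + 2)
  obtain ⟨m, rfl⟩ : ∃ m, n = m + 1 := ⟨n - 1, by omega⟩
  refine ⟨m, by omega, ?_⟩
  have hdist : dist (x + -α) (m • α) = dist x ((m + 1) • α) := by
    rw [dist_eq_norm, dist_eq_norm, succ_nsmul]
    congr 1
    abel
  rw [mem_ball, hdist]
  exact (mem_ball.1 hxn).trans_le
    (hψ (Set.mem_Ici.2 (by omega)) (Set.mem_Ici.2 (by omega)) m.le_succ)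

/-- Zero–one law, from the ergodicity of the rotation by `-α`. -/
theorem ae_mem_approxLimsup_of_pos (hα : addOrderOf α = 0) (hψ : AntitoneOn ψ (Set.Ici 1))
    (hpos : 0 < volume (approxLimsup α ψ)) : ∀ᵐ x, x ∈ approxLimsup α ψ := by
  have hergodic : Ergodic (fun x : UnitAddCircle => x + -α) volume :=
    AddCircle.ergodic_add_right.2 (by rwa [addOrderOf_neg])
  have hmeas : MeasurableSet (approxLimsup α ψ) :=
    MeasurableSet.measurableSet_limsup fun _ => measurableSet_ball
  rcases hergodic.ae_empty_or_univ_of_ae_le_preimage hmeas.nullMeasurableSet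
    (approxLimsup_subset_preimage_add_neg hψ).eventuallyLE with hempty | huniv
  · rw [measure_congr hempty, measure_empty] at hpos
    exact absurd hpos (lt_irrefl 0)
  · exact eventuallyEq_univ.1 huniv

theorem ae_ne_nsmul (α : UnitAddCircle) : ∀ᵐ x : UnitAddCircle, ∀ n : ℕ, n • α ≠ x :=
  ae_all_iff.2 fun n => by
    have hnull : volume {n • α} = 0 := by
      rw [← closedBall_zero, AddCircle.volume_closedBall]
      simp
    filter_upwards [compl_mem_ae_iff.2 hnull] with x hx using Ne.symm hx

theorem mem_approxLimsup_of_mem_limsup_closeApprox {r : ℕ → ℝ} (hr : Tendsto r atTop (nhds 0))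
    {x : UnitAddCircle} (hx : ∀ n : ℕ, n • α ≠ x)
    (h : x ∈ limsup (fun l => closeApprox α ψ (r l)) atTop) : x ∈ approxLimsup α ψ := by
  rw [mem_approxLimsup, Nat.frequently_atTop_iff_infinite]
  intro hfin
  have hfar : ∀ᶠ l in atTop, ∀ n ∈ {n | x ∈ ball (n • α) (ψ n)}, r l < dist x (n • α) :=
    (eventually_all_finite hfin).2 fun n _ =>
      hr.eventually_lt_const (dist_pos.2 (hx n).symm)
  obtain ⟨l, hl, hfar⟩ := ((mem_limsup_iff_frequently_mem.1 h).and_eventually hfar).exists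
  obtain ⟨n, -, hn⟩ := Set.mem_iUnion₂.1 hl
  obtain ⟨hnψ, hnr⟩ := lt_min_iff.1 (mem_ball.1 hn)
  exact lt_asymm hnr (hfar n hnψ)

theorem volume_limsup_closeApprox_le {r : ℕ → ℝ} (hr : Tendsto r atTop (nhds 0)) :
    volume (limsup (fun l => closeApprox α ψ (r l)) atTop) ≤ volume (approxLimsup α ψ) := by
  refine measure_mono_ae ?_
  filter_upwards [ae_ne_nsmul α] with x hx
  exact mem_approxLimsup_of_mem_limsup_closeApprox hr hx

theorem measurableSet_closeApprox (α : UnitAddCircle) (ψ : ℕ → ℝ) (ρ : ℝ) :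
    MeasurableSet (closeApprox α ψ ρ) :=
  (isOpen_biUnion fun _ _ => isOpen_ball).measurableSet

theorem runUnion_subset_closeApprox {q a : ℕ} {r : ℕ → ℝ} {ρ : ℝ}
    (hr : ∀ n < a * q, r (n / q) ≤ min (ψ (n + 1)) ρ) :
    runUnion α q a r ⊆ closeApprox α ψ ρ :=
  Set.iUnion₂_subset fun n hn => (ball_subset_ball (hr n (Finset.mem_range.1 hn))).trans
    (Set.subset_biUnion_of_mem (u := fun n => ball (n • α) (min (ψ n) ρ)) n.succ_pos)

variable {θ : ℝ}

theorem blockSet_subset_closeApprox (hψ : IsApproxSeq ψ) (l : ℕ) :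
    blockSet θ ψ l ⊆ closeApprox θ ψ (1 / (4 * convDenom θ l)) := by
  refine runUnion_subset_closeApprox fun n _ => min_le_min (hψ.anti _ _ n.succ_pos ?_) ?_
  · rw [add_one_mul]
    exact Nat.lt_div_mul_add (convDenom_pos θ l)
  · have := convDenom_cast_pos θ l
    gcongr
    exact convDenom_mono θ l.le_succ

theorem half_le_measureReal_closeApprox (hθ : Irrational θ) (hψ : IsApproxSeq ψ) {l : ℕ}
    (hl : l ≠ 0) (hlarge : 1 / (4 * convDenom θ l) ≤ ψ (convDenom θ l)) :
    1 / 2 ≤ volume.real (closeApprox θ ψ (1 / (4 * convDenom θ l))) := by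
  have hq := convDenom_cast_pos θ l
  have hrun : volume.real (runUnion θ (convDenom θ l) 1 fun _ => 1 / (4 * convDenom θ l)) =
      1 / 2 := by
    rw [measureReal_runUnion (one_div_two_mul_convDenom_le_one θ l) (fun _ => by positivity)
      (fun _ => by field_simp; norm_num)]
    · rw [one_mul, Finset.sum_const, Finset.card_range, nsmul_eq_mul]
      field_simp
      norm_num
    · obtain ⟨l, rfl⟩ := Nat.exists_eq_succ_of_ne_zero hl
      rw [one_mul]
      exact fun n => one_div_le_norm_nsmul hθ
  refine hrun.symm.trans_le (measureReal_mono (runUnion_subset_closeApprox fun n hn =>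
    le_min (hlarge.trans ?_) le_rfl) (measure_ne_top _ _))
  exact hψ.anti _ _ n.succ_pos (one_mul (convDenom θ l) ▸ hn)

theorem volume_limsup_closeApprox_pos {τ : ℝ} (hτ : 1 ≤ τ) (hθ : Irrational θ)
    (hΩ : θ ∈ omegaSet τ) (hψ : IsApproxSeq ψ) (hdiv : PowDiverges τ ψ) :
    0 < volume (limsup (fun l => closeApprox θ ψ (1 / (4 * convDenom θ l))) atTop) := by
  by_cases hlarge : ∃ᶠ l in atTop, 1 / (4 * convDenom θ l) ≤ ψ (convDenom θ l)
  · refine (ENNReal.ofReal_pos.2 one_half_pos).trans_le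
      (le_measure_limsup_of_frequently_le (fun _ => measurableSet_closeApprox _ _ _) ?_)
    refine (hlarge.and_eventually (eventually_ne_atTop 0)).mono fun l ⟨hl, hl₀⟩ => ?_
    exact (ENNReal.ofReal_le_iff_le_toReal (measure_ne_top _ _)).2
      (half_le_measureReal_closeApprox hθ hψ hl₀ hl)
  · have hsmall : ∀ᶠ l in atTop, ψ (convDenom θ l) ≤ 1 / (4 * convDenom θ l) :=
      (not_frequently.1 hlarge).mono fun l hl => (not_le.1 hl).le
    exact (volume_limsup_blockSet_pos hθ hψ
      (not_summable_measureReal_blockSet hτ hθ hΩ hψ hdiv hsmall)).trans_le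
      (measure_mono (limsup_le_limsup (.of_forall (blockSet_subset_closeApprox hψ))))

theorem irrational_of_mem_omegaSet {τ : ℝ} (hθ : θ ∈ omegaSet τ) : Irrational θ := by
  rintro ⟨x, rfl⟩
  obtain ⟨c, hc, hΩ⟩ := hθ
  have : (0 : ℝ) < x.den := Nat.cast_pos.2 x.den_pos
  have hmul : (x.den : ℝ) * x = x.num := by exact_mod_cast x.den_mul_eq_num
  have hzero : distInt (x.den * x) = 0 := by rw [hmul]; simp [distInt]
  have hpos : 0 < c / (x.den : ℝ) ^ τ := by positivity
  exact (hpos.trans_le (hΩ x.den x.den_pos)).ne' hzero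

theorem addOrderOf_coe_eq_zero (hθ : Irrational θ) : addOrderOf (θ : UnitAddCircle) = 0 :=
  AddCircle.denseRange_zsmul_iff.1 (AddCircle.denseRange_zsmul_coe_iff.2 (by rwa [div_one]))

theorem solutions_infinite_of_mem_approxLimsup {s : ℝ}
    (hs : (s : UnitAddCircle) ∈ approxLimsup θ ψ) : (solutions θ ψ s).Infinite := by
  refine Nat.frequently_atTop_iff_infinite.1 ?_
  refine ((mem_approxLimsup.1 hs).and_eventually (eventually_ge_atTop 1)).mono fun n hn => ?_
  refine ⟨hn.2, ?_⟩
  rw [distInt_natCast_mul_sub, ← dist_eq_norm, dist_comm]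
  exact hn.1

theorem omegaSet_subset_thetaSet {τ : ℝ} (hτ : 1 ≤ τ) : omegaSet τ ⊆ thetaSet τ := by
  intro θ hΩ ψ hψ hdiv
  have hθ := irrational_of_mem_omegaSet hΩ
  have hr : Tendsto (fun l => 1 / (4 * (convDenom θ l : ℝ))) atTop (nhds 0) :=
    ((tendsto_natCast_atTop_atTop.comp (tendsto_convDenom hθ)).const_mul_atTop
      four_pos).const_div_atTop 1
  have hpos : 0 < volume (approxLimsup θ ψ) :=
    (volume_limsup_closeApprox_pos hτ hθ hΩ hψ hdiv).trans_le (volume_limsup_closeApprox_le hr)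
  have hae := ae_mem_approxLimsup_of_pos (addOrderOf_coe_eq_zero hθ)
    (fun m hm n _ hmn => hψ.anti m n hm hmn) hpos
  filter_upwards [ae_real_of_ae_circle hae] with s hs
  exact solutions_infinite_of_mem_approxLimsup hs

end Approximable

theorem mainTheorem2 :
    -- Tseng's theorem
    (∀ τ : ℝ, 1 ≤ τ → omegaSet τ = thetaSet τ) ∧
    -- the case `τ = 1`: Kurzweil's theorem
    (∀ θ : ℝ, θ ∈ badlyApproximable ↔
      ∀ ψ : ℕ → ℝ, IsApproxSeq ψ → ¬ Summable (fun n : ℕ => ψ (n + 1)) →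
        ∀ᵐ s : ℝ, (solutions θ ψ s).Infinite) ∧
    -- Tseng's counterexample sequences for `θ` outside `Ω^{(τ)}`
    (∀ τ : ℝ, 1 ≤ τ → ∀ θ : ℝ, θ ∉ omegaSet τ →
      (∃ v : ℕ → ℕ, IsTsengBase τ θ v) ∧
      ∀ v : ℕ → ℕ, IsTsengBase τ θ v →
        (∃ ψ : ℕ → ℝ, IsTsengSeq τ v ψ) ∧
        ∀ ψ : ℕ → ℝ, IsTsengSeq τ v ψ →
          PowDiverges τ ψ ∧
          (Irrational θ → Summable (blockSum θ ψ)) ∧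
          ∀ᵐ s : ℝ, (solutions θ ψ s).Finite) := by
  have hmain : ∀ τ : ℝ, 1 ≤ τ → omegaSet τ = thetaSet τ := fun τ hτ =>
    (omegaSet_subset_thetaSet hτ).antisymm (thetaSet_subset_omegaSet hτ)
  refine ⟨hmain, fun θ => ?_, fun τ hτ θ hθ => ⟨exists_isTsengBase hθ, fun v hv =>
    ⟨hv.exists_isTsengSeq hτ, fun ψ hψ => ⟨hψ.powDiverges hv hτ, hψ.summable_blockSum hv hτ,
      hψ.ae_finite_solutions hv hτ⟩⟩⟩⟩
  have hbad : θ ∈ badlyApproximable ↔ θ ∈ omegaSet 1 := by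
    simp only [badlyApproximable, omegaSet, Real.rpow_one]
  rw [hbad, hmain 1 le_rfl]
  simp only [thetaSet, PowDiverges, Real.rpow_one, Set.mem_ofPred_eq]
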